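/- Let $I,J\subseteq\mathbb R$ be open intervals and let $f,g,h,k:I\times J\to\mathbb C$ be smooth, $f$ and $g$ without zeros; write $h=h_1+ih_2$, $k=k_1+ik_2$. Consider $$i\psi_t+f\psi_{xx}+g|\psi|^2\psi+h\psi+k\psi_x=0 ,\qquad (1)$$ together with its complex conjugate, as a system for $u=\psi$ and $v=\bar\psi$ regarded as independent functions: $$iu_t+fu_{xx}+gu^2v+hu+ku_x=0,\qquad -iv_t+\bar fv_{xx}+\bar guv^2+\bar hv+\bar kv_x=0 .$$ For a real analytic $\Phi:I\times J\to\mathbb R$ with $\Phi_x\neq0$ everywhere and integers $\alpha,\beta<0$, a *Painlevé expansion* is a pair of formal series $u=\sum_{j\ge0}u_j\Phi^{\alpha+j}$, $v=\sum_{j\ge0}v_j\Phi^{\beta+j}$ with analytic $u_j,v_j:I\times J\to\mathbb C$, $u_0$ and $v_0$ without zeros, such that after substitution into the system the coefficient of every power of $\Phi$ vanishes identically. Equation (1) *passes the Painlevé test* if for some $\alpha,\beta<0$ the expansion contains four arbitrary functions, one of which is $\Phi$: there are three places among the coefficients $u_0,v_0,u_1,v_1,\dots$ such that for every such $\Phi$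 and every choice of analytic functions at these three places (without zeros at a place $u_0$ or $v_0$) there is exactly one Painlevé expansion with these coefficients. (a) If (1) passes the Painlevé test, then $f$ and $g$ are real, $$k_1=\tfrac12f_x+f\frac{g_x}{g},$$ and there is a smooth function $\gamma(t)$ on $J$ such that $$h_2=\tfrac14\Big(\big(\ln\big|\tfrac{g^2}{f}\big|\big)_t+k_2\big(\ln\big|\tfrac{g^2}{f}\big|\big)_x+2k_{2,x}\Big)+\gamma(t),$$ and $$\begin{aligned} f_xh_{1,x}+2fh_{1,xx}={}&4\gamma^2+2\dot\gamma-\frac{3f_t^2}{4f^2}+\frac{f_{tt}}{2f}-\frac{3k_2f_tf_x}{2f^2}+\frac{k_{2,t}f_x}{2f}-\frac{3k_2^2f_x^2}{4f^2}+\frac{k_{2,x}f_t}{f}+\frac{3k_2k_{2,x}f_x}{2f}\\ &-k_{2,x}^2+\frac{k_2f_{xt}}{f}-k_{2,xt}+\frac{k_2^2f_{xx}}{2f}-k_2k_{2,xx}-\frac{f_x^2g_x^2}{2g^2}+\frac{7ff_xg_x^3}{2g^3}-\frac{3f^2g_x^4}{g^4}\\ &+\frac{f_xg_xf_{xx}}{4g}-\frac{3ff_{xx}g_x^2}{2g^2}+\frac{3f_x^2g_{xx}}{4g}-\frac{13ff_xg_xg_{xx}}{2g^2}+\frac{7f^2g_x^2g_{xx}}{g^3}+\frac{2ff_{xx}g_{xx}}{g}\\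 &-\frac{2f^2g_{xx}^2}{g^2}+\frac{fg_xf_{xxx}}{2g}+\frac{3ff_xg_{xxx}}{g}-\frac{3f^2g_xg_{xxx}}{g^2}+\frac{f^2g_{xxxx}}{g}.\qquad(2) \end{aligned}$$ Consequently, for every base point $x_0\in I$ there are smooth functions $A(t),B(t)$ on $J$ such that, all integrals in $x$ being taken from $x_0$, $$\begin{aligned}h_1={}&\int\frac1{\sqrt{|f|}}\Big(\int F_\varepsilon\,dx\Big)dx+\frac{f_xg_x}{4g}-\frac{fg_x^2}{4g^2}+\frac{fg_{xx}}{2g}\\&+\int\frac1{2f}\Big(\frac{k_2f_t}{f}-k_{2,t}+\frac{k_2^2f_x}{2f}-k_2k_{2,x}\Big)dx+A(t)\int\frac{dx}{\sqrt{|f|}}+B(t),\end{aligned}\qquad(3)$$ where $F_\varepsilon=\frac{\varepsilon}{\sqrt{|f|}}\big(2\gamma^2+\dot\gamma-\frac{3f_t^2}{8f^2}+\frac{f_{tt}}{4f}\big)$ and $\varepsilon=\pm1$ is the sign of $f$. (b) Formula (3) is the general integral of (2): if $f,g$ are real, then for every smooth $\gamma(t)$ and every $x_0\in I$, every smooth real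 solution $h_1$ of (2) has the form (3) with smooth $A,B$, and conversely for arbitrary functions $A(t),B(t)$ the function (3) solves (2). -/

import Mathlib

open scoped ContDiff

noncomputable section

namespace VCNLS

/-- The partial derivative in the first variable `x` of a function of `(x, t)`. -/
def dx {E : Type*} [NormedAddCommGroup E] [NormedSpace ℝ E] (F : ℝ → ℝ → E) : ℝ → ℝ → E :=
  fun x t => deriv (fun y => F y t) x

/-- The partial derivative in the second variable `t` of a function of `(x, t)`. -/
def dt {E : Type*} [NormedAddCommGroup E] [NormedSpace ℝ E] (F : ℝ → ℝ → E) : ℝ → ℝ → E :=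
  fun x t => deriv (fun s => F x s) t

/-- `F` is smooth in `(x, t)` on `I × J`. -/
def SmoothOn {E : Type*} [NormedAddCommGroup E] [NormedSpace ℝ E]
    (I J : Set ℝ) (F : ℝ → ℝ → E) : Prop :=
  ContDiffOn ℝ ∞ (Function.uncurry F) (I ×ˢ J)

/-- `F` is (real) analytic in `(x, t)` on `I × J`. -/
def RealAnalyticOn {E : Type*} [NormedAddCommGroup E] [NormedSpace ℝ E]
    (I J : Set ℝ) (F : ℝ → ℝ → E) : Prop :=
  AnalyticOnNhd ℝ (Function.uncurry F) (I ×ˢ J)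

/-- The pointwise complex conjugate. -/
def cconj (F : ℝ → ℝ → ℂ) : ℝ → ℝ → ℂ := fun x t => starRingEnd ℂ (F x t)

/-- The pointwise real part. -/
def rePart (F : ℝ → ℝ → ℂ) : ℝ → ℝ → ℝ := fun x t => (F x t).re

/-- The pointwise imaginary part. -/
def imPart (F : ℝ → ℝ → ℂ) : ℝ → ℝ → ℝ := fun x t => (F x t).im

/-! ### Formal expansions in powers of `Φ`

A formal Laurent expansion `∑ₘ c m · Φ ^ m` whose coefficients are functions of `(x, t)` is
represented by the family `c : ℤ → ℝ → ℝ → ℂ` of its coefficients. -/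

/-- The coefficient of `Φ ^ m` in the expansion `∑ⱼ u j · Φ ^ (α + j)`. -/
def laurent (α : ℤ) (u : ℕ → ℝ → ℝ → ℂ) (m : ℤ) : ℝ → ℝ → ℂ :=
  if α ≤ m then u (m - α).toNat else 0

/-- Termwise `∂/∂x` of `∑ₘ c m · Φ ^ m`: the coefficient of `Φ ^ m` is
`∂ₓ (c m) + (m + 1) · Φₓ · c (m + 1)`. -/
def formalDx (Φ : ℝ → ℝ → ℝ) (c : ℤ → ℝ → ℝ → ℂ) (m : ℤ) : ℝ → ℝ → ℂ :=
  fun x t => dx (c m) x t + ((m : ℂ) + 1) * ((dx Φ x t : ℝ) : ℂ) * c (m + 1) x t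

/-- Termwise `∂/∂t` of `∑ₘ c m · Φ ^ m`. -/
def formalDt (Φ : ℝ → ℝ → ℝ) (c : ℤ → ℝ → ℝ → ℂ) (m : ℤ) : ℝ → ℝ → ℂ :=
  fun x t => dt (c m) x t + ((m : ℂ) + 1) * ((dt Φ x t : ℝ) : ℂ) * c (m + 1) x t

/-- The coefficient of `Φ ^ m` in the Cauchy product `u² v` of the expansions
`u = ∑ⱼ u j · Φ ^ (α + j)` and `v = ∑ⱼ v j · Φ ^ (β + j)`. -/
def cubic (α β : ℤ) (u v : ℕ → ℝ → ℝ → ℂ) (m : ℤ) : ℝ → ℝ → ℂ :=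
  fun x t =>
    if 2 * α + β ≤ m then
      ∑ p ∈ Finset.HasAntidiagonal.antidiagonal (m - (2 * α + β)).toNat,
        (∑ q ∈ Finset.HasAntidiagonal.antidiagonal p.1, u q.1 x t * u q.2 x t) * v p.2 x t
    else 0

/-- The coefficient of `Φ ^ m` after substituting the two expansions into
`σ u_t + f u_xx + g u² v + h u + k u_x`. -/
def substCoeff (σ : ℂ) (f g h k : ℝ → ℝ → ℂ) (Φ : ℝ → ℝ → ℝ) (α β : ℤ)
    (u v : ℕ → ℝ → ℝ → ℂ) (m : ℤ) : ℝ → ℝ → ℂ :=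
  fun x t =>
    σ * formalDt Φ (laurent α u) m x t
      + f x t * formalDx Φ (formalDx Φ (laurent α u)) m x t
      + g x t * cubic α β u v m x t
      + h x t * laurent α u m x t
      + k x t * formalDx Φ (laurent α u) m x t

/-- `u = ∑ⱼ u j · Φ ^ (α + j)`, `v = ∑ⱼ v j · Φ ^ (β + j)` is a Painlevé expansion on `I × J` of
`i ψ_t + f ψ_xx + g |ψ|² ψ + h ψ + k ψ_x = 0`, written together with its complex conjugate as a
system for the independent functions `u` (for `ψ`) and `v` (for its conjugate): the coefficients
are analytic, the leading ones do not vanish, and after substitution into the two equations the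
coefficient of every power of `Φ` vanishes identically. -/
structure IsPainleveExpansion (I J : Set ℝ) (f g h k : ℝ → ℝ → ℂ) (Φ : ℝ → ℝ → ℝ) (α β : ℤ)
    (u v : ℕ → ℝ → ℝ → ℂ) : Prop where
  analytic_u : ∀ j, RealAnalyticOn I J (u j)
  analytic_v : ∀ j, RealAnalyticOn I J (v j)
  leading_u : ∀ x ∈ I, ∀ t ∈ J, u 0 x t ≠ 0
  leading_v : ∀ x ∈ I, ∀ t ∈ J, v 0 x t ≠ 0
  eq_u : ∀ m : ℤ, ∀ x ∈ I, ∀ t ∈ J,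
    substCoeff Complex.I f g h k Φ α β u v m x t = 0
  eq_v : ∀ m : ℤ, ∀ x ∈ I, ∀ t ∈ J,
    substCoeff (-Complex.I) (cconj f) (cconj g) (cconj h) (cconj k) Φ β α v u m x t = 0

/-- The Painlevé test. The system is of second order in `x` for two unknown functions, so by the
Cauchy–Kovalevskaya theorem the general solution depends on four arbitrary functions. The test
asks that for suitable negative integers `α`, `β` the singularity manifold function `Φ`
(non-characteristic: `Φₓ ≠ 0`) is one of them, and that the other three are expansion
coefficients: there are three places `S` among the coefficients (`Sum.inl j` stands for `u j` and
`Sum.inr j` for `v j`) such that, whatever `Φ` is, the coefficients at these places can be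
prescribed arbitrarily (a leading coefficient without zeros), and all others are then determined. -/
def PassesPainleveTest (I J : Set ℝ) (f g h k : ℝ → ℝ → ℂ) : Prop :=
  ∃ α β : ℤ, α < 0 ∧ β < 0 ∧ ∃ S : Finset (ℕ ⊕ ℕ), S.card = 3 ∧
    ∀ Φ : ℝ → ℝ → ℝ, RealAnalyticOn I J Φ → (∀ x ∈ I, ∀ t ∈ J, dx Φ x t ≠ 0) →
    ∀ a : ℕ ⊕ ℕ → ℝ → ℝ → ℂ,
      (∀ s ∈ S, RealAnalyticOn I J (a s)) →
      (∀ s ∈ S, s = Sum.inl 0 ∨ s = Sum.inr 0 → ∀ x ∈ I, ∀ t ∈ J, a s x t ≠ 0) →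
      (∃ u v : ℕ → ℝ → ℝ → ℂ, IsPainleveExpansion I J f g h k Φ α β u v ∧
        ∀ s ∈ S, ∀ x ∈ I, ∀ t ∈ J, Sum.elim u v s x t = a s x t) ∧
      (∀ u v u' v' : ℕ → ℝ → ℝ → ℂ,
        IsPainleveExpansion I J f g h k Φ α β u v →
        IsPainleveExpansion I J f g h k Φ α β u' v' →
        (∀ s ∈ S, ∀ x ∈ I, ∀ t ∈ J, Sum.elim u v s x t = a s x t) →
        (∀ s ∈ S, ∀ x ∈ I, ∀ t ∈ J, Sum.elim u' v' s x t = a s x t) →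
        ∀ j, ∀ x ∈ I, ∀ t ∈ J, u j x t = u' j x t ∧ v j x t = v' j x t)

/-! ### The explicit conditions, for real `f`, `g`, `k₂` and `h₁` -/

/-- `¼ ((ln (g²/f))_t + k₂ (ln (g²/f))_x + 2 k₂_x) + γ`. Here `Real.log y = ln |y|`. -/
def imPotential (f g k₂ : ℝ → ℝ → ℝ) (γ : ℝ → ℝ) (x t : ℝ) : ℝ :=
  1 / 4 * (dt (fun x t => Real.log (g x t ^ 2 / f x t)) x t
    + k₂ x t * dx (fun x t => Real.log (g x t ^ 2 / f x t)) x t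
    + 2 * dx k₂ x t) + γ t

/-- The right-hand side of the second-order equation for `h₁`. -/
def potentialRHS (f g k₂ : ℝ → ℝ → ℝ) (γ : ℝ → ℝ) (x t : ℝ) : ℝ :=
  let F := f x t
  let Fx := dx f x t
  let Fxx := dx (dx f) x t
  let Fxxx := dx (dx (dx f)) x t
  let Ft := dt f x t
  let Ftt := dt (dt f) x t
  let Fxt := dt (dx f) x t
  let G := g x t
  let Gx := dx g x t
  let Gxx := dx (dx g) x t
  let Gxxx := dx (dx (dx g)) x t
  let Gxxxx := dx (dx (dx (dx g))) x t
  let K := k₂ x t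
  let Kx := dx k₂ x t
  let Kxx := dx (dx k₂) x t
  let Kt := dt k₂ x t
  let Kxt := dt (dx k₂) x t
  4 * γ t ^ 2 + 2 * deriv γ t - 3 * Ft ^ 2 / (4 * F ^ 2) + Ftt / (2 * F)
    - 3 * K * Ft * Fx / (2 * F ^ 2) + Kt * Fx / (2 * F) - 3 * K ^ 2 * Fx ^ 2 / (4 * F ^ 2)
    + Kx * Ft / F + 3 * K * Kx * Fx / (2 * F) - Kx ^ 2 + K * Fxt / F - Kxt
    + K ^ 2 * Fxx / (2 * F) - K * Kxx
    - Fx ^ 2 * Gx ^ 2 / (2 * G ^ 2) + 7 * F * Fx * Gx ^ 3 / (2 * G ^ 3)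
    - 3 * F ^ 2 * Gx ^ 4 / G ^ 4 + Fx * Gx * Fxx / (4 * G) - 3 * F * Fxx * Gx ^ 2 / (2 * G ^ 2)
    + 3 * Fx ^ 2 * Gxx / (4 * G) - 13 * F * Fx * Gx * Gxx / (2 * G ^ 2)
    + 7 * F ^ 2 * Gx ^ 2 * Gxx / G ^ 3 + 2 * F * Fxx * Gxx / G - 2 * F ^ 2 * Gxx ^ 2 / G ^ 2
    + F * Gx * Fxxx / (2 * G) + 3 * F * Fx * Gxxx / G - 3 * F ^ 2 * Gx * Gxxx / G ^ 2
    + F ^ 2 * Gxxxx / G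

/-- The second-order equation `f_x h₁_x + 2 f h₁_xx = …` on `I × J`. -/
def PotentialEquation (I J : Set ℝ) (f g k₂ : ℝ → ℝ → ℝ) (γ : ℝ → ℝ) (h₁ : ℝ → ℝ → ℝ) : Prop :=
  ∀ x ∈ I, ∀ t ∈ J,
    dx f x t * dx h₁ x t + 2 * f x t * dx (dx h₁) x t = potentialRHS f g k₂ γ x t

/-- `F_ε = (ε / √|f|) (2 γ² + γ' - 3 f_t² / (8 f²) + f_tt / (4 f))`, `ε` the sign of `f`. -/
def Feps (f : ℝ → ℝ → ℝ) (γ : ℝ → ℝ) (x t : ℝ) : ℝ :=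
  Real.sign (f x t) / √|f x t| *
    (2 * γ t ^ 2 + deriv γ t - 3 * dt f x t ^ 2 / (8 * f x t ^ 2) + dt (dt f) x t / (4 * f x t))

/-- The expression `(k₂ / (2 f)) ((ln (|f| / k₂))_t + k₂ (ln (√|f| / k₂))_x)` with the logarithmic
derivatives carried out, which gives it a meaning at the zeros of `k₂` too. -/
def driftTerm (f k₂ : ℝ → ℝ → ℝ) (x t : ℝ) : ℝ :=
  1 / (2 * f x t) *
    (k₂ x t * dt f x t / f x t - dt k₂ x t
      + k₂ x t ^ 2 * dx f x t / (2 * f x t) - k₂ x t * dx k₂ x t)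

/-- The explicit real part of the potential; the indefinite integrals in `x` are based at `x₀`. -/
def rePotential (f g k₂ : ℝ → ℝ → ℝ) (γ A B : ℝ → ℝ) (x₀ x t : ℝ) : ℝ :=
  (∫ y in x₀..x, 1 / √|f y t| * ∫ z in x₀..y, Feps f γ z t)
    + dx f x t * dx g x t / (4 * g x t) - f x t * dx g x t ^ 2 / (4 * g x t ^ 2)
    + f x t * dx (dx g) x t / (2 * g x t)
    + (∫ y in x₀..x, driftTerm f k₂ y t)
    + A t * (∫ y in x₀..x, 1 / √|f y t|) + B t

end VCNLS

end

/-! The test is used only through the expansions it supplies for special `Φ`. The lowest power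
forces both exponents to be `-1`, and the next fact needed is an expansion with `u₀ = 1`. It exists
because the system is invariant under `(u, v) ↦ (c u, c⁻¹ v)`: if neither leading coefficient were a
free place, prescribing zeros would contradict uniqueness.

All further computation takes place in the algebra of smooth functions on `I × J` with its commuting
derivations `X = ∂ₓ` and `T = ∂ₜ`. With `Y = Φₓ⁻¹ X` and `E = T - Φₜ Y`, so that `Y Φ = 1` and `E Φ
= 0`, and with the leading coefficients divided out, the system takes a normal form. Its order `j`
equations have the matrix with diagonal entries `(j-1)(j-2) - 4` and off-diagonal entries `-2`,
which is singular exactly for `j = -1, 0, 3, 4`. The orders 3 and 4 therefore each give one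
differential condition on the coefficients of the equation, `compatThree` and `compatFour`.

Along `Φ = x + c t` these conditions are polynomial in the integer `c`. Finite differences in `c`
isolate the top coefficients, which force `1/f` to equal its conjugate; the leading order then makes
`g` real. The next difference gives `dₓ (d k + 3 dₓ) = 0` for `d = 2i/f` and an expression `k` in
the drift. The family `Φ = exp x + c t` gives the same with `dₓ - 2d` in place of the first factor,
so the second factor vanishes even where `fₓ = 0`; this is the formula for `k₁`
(`Coefficients.drift`). With `Φ = x` alone, order 3 becomes `γₓ = 0` (`compatThree_eq`) and order 4
becomes the equation for `h₁` (`compatFour_eq`).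

That equation is linear in `h₁ₓ`, with homogeneous solutions proportional to `1/√|f|`. The two
integrated or explicit correction terms in (3) absorb everything on the right except twice the
bracket of `F_ε` (`corrections`), and the rest is variation of constants, with `A` and `B` read off
at `x₀`. -/

noncomputable section

namespace VCNLS

open TopologicalSpace Set

/-! ### Partial derivatives of smooth functions on an open rectangle -/

section Calculus

variable {E : Type*} [NormedAddCommGroup E] [NormedSpace ℝ E] {I J : Opens ℝ}
  {F G : ℝ → ℝ → E} {x t : ℝ}

theorem isOpen_prod (I J : Opens ℝ) : IsOpen ((I : Set ℝ) ×ˢ (J : Set ℝ)) :=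
  I.isOpen.prod J.isOpen

theorem SmoothOn.contDiffAt (hF : SmoothOn I J F) (hx : x ∈ I) (ht : t ∈ J) :
    ContDiffAt ℝ ∞ (Function.uncurry F) (x, t) :=
  ContDiffOn.contDiffAt hF ((isOpen_prod I J).mem_nhds ⟨hx, ht⟩)

theorem SmoothOn.differentiableAt (hF : SmoothOn I J F) (hx : x ∈ I) (ht : t ∈ J) :
    DifferentiableAt ℝ (Function.uncurry F) (x, t) :=
  (hF.contDiffAt hx ht).differentiableAt (by simp)

theorem SmoothOn.hasDerivAt_fderiv_x (hF : SmoothOn I J F) (hx : x ∈ I) (ht : t ∈ J) :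
    HasDerivAt (fun y => F y t) (fderiv ℝ (Function.uncurry F) (x, t) (1, 0)) x :=
  HasFDerivAt.comp_hasDerivAt (f := fun y : ℝ => (y, t)) x
    (hF.differentiableAt hx ht).hasFDerivAt ((hasDerivAt_id x).prodMk (hasDerivAt_const x t))

theorem SmoothOn.hasDerivAt_fderiv_t (hF : SmoothOn I J F) (hx : x ∈ I) (ht : t ∈ J) :
    HasDerivAt (fun s => F x s) (fderiv ℝ (Function.uncurry F) (x, t) (0, 1)) t :=
  HasFDerivAt.comp_hasDerivAt (f := fun s : ℝ => (x, s)) t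
    (hF.differentiableAt hx ht).hasFDerivAt ((hasDerivAt_const t x).prodMk (hasDerivAt_id t))

theorem SmoothOn.dx_eq (hF : SmoothOn I J F) (hx : x ∈ I) (ht : t ∈ J) :
    dx F x t = fderiv ℝ (Function.uncurry F) (x, t) (1, 0) :=
  (hF.hasDerivAt_fderiv_x hx ht).deriv

theorem SmoothOn.dt_eq (hF : SmoothOn I J F) (hx : x ∈ I) (ht : t ∈ J) :
    dt F x t = fderiv ℝ (Function.uncurry F) (x, t) (0, 1) :=
  (hF.hasDerivAt_fderiv_t hx ht).deriv

theorem SmoothOn.hasDerivAt_dx (hF : SmoothOn I J F) (hx : x ∈ I) (ht : t ∈ J) :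
    HasDerivAt (fun y => F y t) (dx F x t) x :=
  hF.dx_eq hx ht ▸ hF.hasDerivAt_fderiv_x hx ht

theorem SmoothOn.hasDerivAt_dt (hF : SmoothOn I J F) (hx : x ∈ I) (ht : t ∈ J) :
    HasDerivAt (fun s => F x s) (dt F x t) t :=
  hF.dt_eq hx ht ▸ hF.hasDerivAt_fderiv_t hx ht

theorem SmoothOn.congr (hF : SmoothOn I J F) (h : ∀ x ∈ I, ∀ t ∈ J, G x t = F x t) :
    SmoothOn I J G :=
  ContDiffOn.congr hF fun p hp => h p.1 hp.1 p.2 hp.2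

theorem SmoothOn.fderiv_apply (hF : SmoothOn I J F) (v : ℝ × ℝ) :
    ContDiffOn ℝ ∞ (fun p => fderiv ℝ (Function.uncurry F) p v) ((I : Set ℝ) ×ˢ (J : Set ℝ)) :=
  (ContDiffOn.fderiv_of_isOpen hF (isOpen_prod I J) (by simp)).clm_apply contDiffOn_const

theorem SmoothOn.dx (hF : SmoothOn I J F) : SmoothOn I J (dx F) :=
  (hF.fderiv_apply (1, 0)).congr fun _ hp => hF.dx_eq hp.1 hp.2

theorem SmoothOn.dt (hF : SmoothOn I J F) : SmoothOn I J (dt F) :=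
  (hF.fderiv_apply (0, 1)).congr fun _ hp => hF.dt_eq hp.1 hp.2

theorem dx_congr (h : ∀ x ∈ I, ∀ t ∈ J, F x t = G x t) (hx : x ∈ I) (ht : t ∈ J) :
    dx F x t = dx G x t :=
  Filter.EventuallyEq.deriv_eq <|
    (I.isOpen.mem_nhds hx |> Filter.mem_of_superset) fun y hy => h y hy t ht

theorem dt_congr (h : ∀ x ∈ I, ∀ t ∈ J, F x t = G x t) (hx : x ∈ I) (ht : t ∈ J) :
    dt F x t = dt G x t :=
  Filter.EventuallyEq.deriv_eq <|
    (J.isOpen.mem_nhds ht |> Filter.mem_of_superset) fun s hs => h x hx s hs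

theorem SmoothOn.dx_dt_comm (hF : SmoothOn I J F) (hx : x ∈ I) (ht : t ∈ J) :
    VCNLS.dx (VCNLS.dt F) x t = VCNLS.dt (VCNLS.dx F) x t := by
  have hsymm : IsSymmSndFDerivAt ℝ (Function.uncurry F) (x, t) :=
    (hF.contDiffAt hx ht).isSymmSndFDerivAt (by
      rw [minSmoothness_of_isRCLikeNormedField]
      exact WithTop.coe_le_coe.2 (le_top : (2 : ℕ∞) ≤ ⊤))
  have hd : DifferentiableAt ℝ (fderiv ℝ (Function.uncurry F)) (x, t) :=
    (((ContDiffOn.fderiv_of_isOpen (m := ∞) hF (isOpen_prod I J) (by simp)).contDiffAt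
      ((isOpen_prod I J).mem_nhds ⟨hx, ht⟩))).differentiableAt (by simp)
  have key : ∀ v w : ℝ × ℝ, fderiv ℝ (fun p => fderiv ℝ (Function.uncurry F) p v) (x, t) w =
      fderiv ℝ (fderiv ℝ (Function.uncurry F)) (x, t) w v := fun v w => by
    rw [fderiv_clm_apply hd (differentiableAt_const v)]
    simp
  have h1 : VCNLS.dx (VCNLS.dt F) x t =
      VCNLS.dx (fun x t => fderiv ℝ (Function.uncurry F) (x, t) (0, 1)) x t :=
    dx_congr (fun x hx t ht => hF.dt_eq hx ht) hx ht
  have h2 : VCNLS.dt (VCNLS.dx F) x t =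
      VCNLS.dt (fun x t => fderiv ℝ (Function.uncurry F) (x, t) (1, 0)) x t :=
    dt_congr (fun x hx t ht => hF.dx_eq hx ht) hx ht
  have s1 : SmoothOn I J (fun x t => fderiv ℝ (Function.uncurry F) (x, t) (0, 1)) :=
    hF.fderiv_apply (0, 1)
  have s2 : SmoothOn I J (fun x t => fderiv ℝ (Function.uncurry F) (x, t) (1, 0)) :=
    hF.fderiv_apply (1, 0)
  rw [h1, h2, s1.dx_eq hx ht, s2.dt_eq hx ht]
  exact (key (0, 1) (1, 0)).trans ((hsymm _ _).trans (key (1, 0) (0, 1)).symm)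

end Calculus

/-! ### The differential algebra of smooth functions -/

section Ring

variable {𝕜 : Type*} [NormedField 𝕜] {I J : Opens ℝ}

open Classical in
/-- The extension by zero of a function on `I × J`. -/
def extendZero (φ : ↥((I : Set ℝ) ×ˢ (J : Set ℝ)) → 𝕜) (x t : ℝ) : 𝕜 :=
  if h : (x, t) ∈ (I : Set ℝ) ×ˢ (J : Set ℝ) then φ ⟨(x, t), h⟩ else 0

theorem extendZero_apply (φ : ↥((I : Set ℝ) ×ˢ (J : Set ℝ)) → 𝕜) {x t : ℝ} (hx : x ∈ I)
    (ht : t ∈ J) : extendZero φ x t = φ ⟨(x, t), hx, ht⟩ :=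
  dif_pos (show (x, t) ∈ (I : Set ℝ) ×ˢ (J : Set ℝ) from ⟨hx, ht⟩)

variable [NormedAlgebra ℝ 𝕜]

theorem SmoothOn.extendZero {F : ℝ → ℝ → 𝕜} (hF : SmoothOn I J F) :
    SmoothOn I J (extendZero fun p : ↥((I : Set ℝ) ×ˢ (J : Set ℝ)) => F p.1.1 p.1.2) :=
  hF.congr fun _ hx _ ht => extendZero_apply _ hx ht

variable (𝕜 I J) in
/-- The algebra of smooth functions on `I × J`. -/
def SmoothRing : Subalgebra 𝕜 (↥((I : Set ℝ) ×ˢ (J : Set ℝ)) → 𝕜) where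
  carrier := {φ | SmoothOn I J (extendZero φ)}
  mul_mem' {a b} ha hb := SmoothOn.congr (F := fun x t => extendZero a x t * extendZero b x t)
    (ContDiffOn.mul ha hb) fun x hx t ht => by simp [extendZero_apply _ hx ht]
  add_mem' {a b} ha hb := SmoothOn.congr (F := fun x t => extendZero a x t + extendZero b x t)
    (ContDiffOn.add ha hb) fun x hx t ht => by simp [extendZero_apply _ hx ht]
  algebraMap_mem' c := SmoothOn.congr (F := fun _ _ => c) contDiffOn_const
    fun x hx t ht => by simp [extendZero_apply _ hx ht]

/-- The element of the algebra of smooth functions given by `F`. -/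
def SmoothOn.toRing {F : ℝ → ℝ → 𝕜} (hF : SmoothOn I J F) : SmoothRing 𝕜 I J :=
  ⟨fun p => F p.1.1 p.1.2, hF.extendZero⟩

namespace SmoothRing

/-- The value of an element of the algebra of smooth functions at a point of `I × J`. -/
def ev (p : ↥((I : Set ℝ) ×ˢ (J : Set ℝ))) : SmoothRing 𝕜 I J →ₐ[𝕜] 𝕜 :=
  (Pi.evalAlgHom 𝕜 (fun _ => 𝕜) p).comp (SmoothRing 𝕜 I J).val

theorem ext_ev {φ ψ : SmoothRing 𝕜 I J} (h : ∀ p, ev p φ = ev p ψ) : φ = ψ :=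
  Subtype.ext (funext h)

/-- The function `F` on the plane restricts to the element `φ` of the algebra of smooth
functions on `I × J`. -/
def Rep (F : ℝ → ℝ → 𝕜) (φ : SmoothRing 𝕜 I J) : Prop :=
  SmoothOn I J F ∧ ∀ p, ev p φ = F p.1.1 p.1.2

theorem rep_toRing {F : ℝ → ℝ → 𝕜} (hF : SmoothOn I J F) : Rep F hF.toRing :=
  ⟨hF, fun _ => rfl⟩

theorem rep_extendZero (φ : SmoothRing 𝕜 I J) : Rep (extendZero φ.1) φ :=
  ⟨φ.2, fun p => (extendZero_apply φ.1 p.2.1 p.2.2).symm⟩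

theorem Rep.eq {F : ℝ → ℝ → 𝕜} {φ ψ : SmoothRing 𝕜 I J} (h : Rep F φ) (h' : Rep F ψ) : φ = ψ :=
  ext_ev fun p => (h.2 p).trans (h'.2 p).symm

theorem Rep.apply {F : ℝ → ℝ → 𝕜} {φ : SmoothRing 𝕜 I J} (h : Rep F φ) {x t : ℝ} (hx : x ∈ I)
    (ht : t ∈ J) : F x t = ev ⟨(x, t), hx, ht⟩ φ := (h.2 ⟨(x, t), hx, ht⟩).symm

theorem Rep.congr {F G : ℝ → ℝ → 𝕜} {φ : SmoothRing 𝕜 I J} (h : Rep F φ)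
    (hG : ∀ x ∈ I, ∀ t ∈ J, G x t = F x t) : Rep G φ :=
  ⟨h.1.congr hG, fun p => (h.2 p).trans (hG _ p.2.1 _ p.2.2).symm⟩

theorem Rep.eq_zero {F : ℝ → ℝ → 𝕜} {φ : SmoothRing 𝕜 I J} (h : Rep F φ)
    (hF : ∀ x ∈ I, ∀ t ∈ J, F x t = 0) : φ = 0 :=
  ext_ev fun p => by rw [h.2 p, hF _ p.2.1 _ p.2.2, map_zero]

theorem Rep.add {F G : ℝ → ℝ → 𝕜} {φ ψ : SmoothRing 𝕜 I J} (h : Rep F φ) (h' : Rep G ψ) :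
    Rep (fun x t => F x t + G x t) (φ + ψ) :=
  ⟨ContDiffOn.add h.1 h'.1, fun p => by rw [map_add, h.2, h'.2]⟩

theorem Rep.mul {F G : ℝ → ℝ → 𝕜} {φ ψ : SmoothRing 𝕜 I J} (h : Rep F φ) (h' : Rep G ψ) :
    Rep (fun x t => F x t * G x t) (φ * ψ) :=
  ⟨ContDiffOn.mul h.1 h'.1, fun p => by rw [map_mul, h.2, h'.2]⟩

theorem rep_algebraMap (c : 𝕜) :
    Rep (fun _ _ => c) (algebraMap 𝕜 (SmoothRing 𝕜 I J) c) :=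
  ⟨contDiffOn_const, fun p => (ev p).commutes c⟩

theorem rep_zero : Rep (fun _ _ => 0) (0 : SmoothRing 𝕜 I J) :=
  ⟨contDiffOn_const, fun p => map_zero (ev p)⟩

theorem rep_one : Rep (fun _ _ => 1) (1 : SmoothRing 𝕜 I J) :=
  ⟨contDiffOn_const, fun p => map_one (ev p)⟩

theorem Rep.sum {ι : Type*} {s : Finset ι} {F : ι → ℝ → ℝ → 𝕜} {φ : ι → SmoothRing 𝕜 I J}
    (h : ∀ i, Rep (F i) (φ i)) : Rep (fun x t => ∑ i ∈ s, F i x t) (∑ i ∈ s, φ i) :=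
  ⟨ContDiffOn.sum fun i _ => (h i).1, fun p => by
    rw [map_sum]; exact Finset.sum_congr rfl fun i _ => (h i).2 p⟩

theorem exists_mul_eq_one (φ : SmoothRing 𝕜 I J) (h : ∀ p, ev p φ ≠ 0) :
    ∃ ψ : SmoothRing 𝕜 I J, φ * ψ = 1 := by
  have hs : SmoothOn I J fun x t => (extendZero φ.1 x t)⁻¹ :=
    ContDiffOn.inv (rep_extendZero φ).1 fun p hp => by
      have := (rep_extendZero φ).apply hp.1 hp.2
      exact this ▸ h _
  refine ⟨hs.toRing, ext_ev fun p => ?_⟩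
  rw [map_mul, (rep_toRing hs).2, (rep_extendZero φ).2, map_one]
  exact mul_inv_cancel₀ ((rep_extendZero φ).2 p ▸ h p)

variable (𝕜 I J) in
/-- The derivation `∂/∂x` of the algebra of smooth functions. -/
def X : Derivation 𝕜 (SmoothRing 𝕜 I J) (SmoothRing 𝕜 I J) :=
  Derivation.mk'
    { toFun := fun φ => (rep_extendZero φ).1.dx.toRing
      map_add' := fun φ ψ => ext_ev fun p => by
        rw [map_add, (rep_toRing _).2, (rep_toRing _).2, (rep_toRing _).2]
        rw [dx_congr (fun x hx t ht => ((rep_extendZero (φ + ψ)).apply hx ht).trans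
          (((rep_extendZero φ).add (rep_extendZero ψ)).apply hx ht).symm) p.2.1 p.2.2]
        exact (((rep_extendZero φ).1.hasDerivAt_dx p.2.1 p.2.2).add
          ((rep_extendZero ψ).1.hasDerivAt_dx p.2.1 p.2.2)).deriv
      map_smul' := fun c φ => ext_ev fun p => by
        rw [map_smul, (rep_toRing _).2, (rep_toRing _).2, smul_eq_mul, RingHom.id_apply]
        rw [dx_congr (fun x hx t ht => ((rep_extendZero (c • φ)).apply hx ht).trans
          (Algebra.smul_def c φ ▸
            ((rep_algebraMap c).mul (rep_extendZero φ)).apply hx ht).symm) p.2.1 p.2.2]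
        exact (((rep_extendZero φ).1.hasDerivAt_dx p.2.1 p.2.2).const_mul c).deriv }
    fun φ ψ => ext_ev fun p => by
      simp only [LinearMap.coe_mk, AddHom.coe_mk, smul_eq_mul, map_add, map_mul]
      rw [(rep_toRing _).2, (rep_toRing _).2, (rep_toRing _).2]
      rw [dx_congr (fun x hx t ht => ((rep_extendZero (φ * ψ)).apply hx ht).trans
          (((rep_extendZero φ).mul (rep_extendZero ψ)).apply hx ht).symm) p.2.1 p.2.2]
      rw [(rep_extendZero φ).2, (rep_extendZero ψ).2]
      refine (((rep_extendZero φ).1.hasDerivAt_dx p.2.1 p.2.2).mul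
          ((rep_extendZero ψ).1.hasDerivAt_dx p.2.1 p.2.2)).deriv.trans ?_
      ring

variable (𝕜 I J) in
/-- The derivation `∂/∂t` of the algebra of smooth functions. -/
def T : Derivation 𝕜 (SmoothRing 𝕜 I J) (SmoothRing 𝕜 I J) :=
  Derivation.mk'
    { toFun := fun φ => (rep_extendZero φ).1.dt.toRing
      map_add' := fun φ ψ => ext_ev fun p => by
        rw [map_add, (rep_toRing _).2, (rep_toRing _).2, (rep_toRing _).2]
        rw [dt_congr (fun x hx t ht => ((rep_extendZero (φ + ψ)).apply hx ht).trans
          (((rep_extendZero φ).add (rep_extendZero ψ)).apply hx ht).symm) p.2.1 p.2.2]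
        exact (((rep_extendZero φ).1.hasDerivAt_dt p.2.1 p.2.2).add
          ((rep_extendZero ψ).1.hasDerivAt_dt p.2.1 p.2.2)).deriv
      map_smul' := fun c φ => ext_ev fun p => by
        rw [map_smul, (rep_toRing _).2, (rep_toRing _).2, smul_eq_mul, RingHom.id_apply]
        rw [dt_congr (fun x hx t ht => ((rep_extendZero (c • φ)).apply hx ht).trans
          (Algebra.smul_def c φ ▸
            ((rep_algebraMap c).mul (rep_extendZero φ)).apply hx ht).symm) p.2.1 p.2.2]
        exact (((rep_extendZero φ).1.hasDerivAt_dt p.2.1 p.2.2).const_mul c).deriv }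
    fun φ ψ => ext_ev fun p => by
      simp only [LinearMap.coe_mk, AddHom.coe_mk, smul_eq_mul, map_add, map_mul]
      rw [(rep_toRing _).2, (rep_toRing _).2, (rep_toRing _).2]
      rw [dt_congr (fun x hx t ht => ((rep_extendZero (φ * ψ)).apply hx ht).trans
          (((rep_extendZero φ).mul (rep_extendZero ψ)).apply hx ht).symm) p.2.1 p.2.2]
      rw [(rep_extendZero φ).2, (rep_extendZero ψ).2]
      refine (((rep_extendZero φ).1.hasDerivAt_dt p.2.1 p.2.2).mul
          ((rep_extendZero ψ).1.hasDerivAt_dt p.2.1 p.2.2)).deriv.trans ?_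
      ring

theorem Rep.dx {F : ℝ → ℝ → 𝕜} {φ : SmoothRing 𝕜 I J} (h : Rep F φ) :
    Rep (VCNLS.dx F) (X 𝕜 I J φ) :=
  ⟨h.1.dx, fun p => ((rep_toRing (rep_extendZero φ).1.dx).2 p).trans <|
    dx_congr (fun _ hx _ ht => ((rep_extendZero φ).apply hx ht).trans (h.apply hx ht).symm)
      p.2.1 p.2.2⟩

theorem Rep.dt {F : ℝ → ℝ → 𝕜} {φ : SmoothRing 𝕜 I J} (h : Rep F φ) :
    Rep (VCNLS.dt F) (T 𝕜 I J φ) :=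
  ⟨h.1.dt, fun p => ((rep_toRing (rep_extendZero φ).1.dt).2 p).trans <|
    dt_congr (fun _ hx _ ht => ((rep_extendZero φ).apply hx ht).trans (h.apply hx ht).symm)
      p.2.1 p.2.2⟩

theorem X_T (φ : SmoothRing 𝕜 I J) : X 𝕜 I J (T 𝕜 I J φ) = T 𝕜 I J (X 𝕜 I J φ) :=
  ext_ev fun p => by
    have h := rep_extendZero φ
    rw [h.dt.dx.2, h.dx.dt.2]
    exact h.1.dx_dt_comm p.2.1 p.2.2

end SmoothRing

end Ring

/-! ### Conditions at the resonances 3 and 4 -/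

section Compatibility

variable {𝕜 R : Type*} [CommRing 𝕜] [CommRing R] [Algebra 𝕜 R] (X E : Derivation 𝕜 R R)

theorem _root_.Derivation.map_ofNat (n : ℕ) [n.AtLeastTwo] : X (ofNat(n) : R) = 0 :=
  X.map_natCast n

/-- The compatibility expression at the resonance `3` for the system
`a E u + X² u - 2 u² w + H u + K X u = 0`, `b E w + X² w - 2 u w² + G w + L X w = 0`, in terms of
`s = a + b`, `d = a - b`, `k = K + L`, `m = K - L`, `D = H - G`. -/
def compatThree (s d k m D : R) : R :=
  4 * D * k + 12 * X D - d * E k - 5 * k * X m - k ^ 2 * m - 3 * X k * m - 3 * E m * s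
    - 6 * X (X m)

/-- The compatibility expression at the resonance `4` for the system of `compatThree`;
here `S = H + G`. -/
def compatFour (s d k m S D : R) : R :=
  -72 * D * k * m + 36 * D * k ^ 2 + 72 * D * X k - 108 * D * X m + 108 * D ^ 2
    + 54 * E D * d + 180 * X D * k - 54 * X D * m + 216 * X (X D) + 18 * S * k ^ 2
    + 36 * S * X k + 18 * E S * s + 90 * X S * k + 108 * X (X S) - 9 * d * k * E k
    - 36 * d * k * E m - 9 * d * E k * m - 18 * d * X (E k) - 54 * d * X (E m)
    - 18 * X d * E k - 54 * X d * E m - 12 * k * E k * s - 63 * k * X k * m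
    - 54 * k * X (X k) + 27 * k * m * X m - 27 * k * E m * s - 144 * k * X (X m)
    - 30 * k ^ 2 * X k + 9 * k ^ 2 * m ^ 2 - 63 * k ^ 2 * X m - 9 * k ^ 3 * m - 2 * k ^ 4
    - 18 * E k * X s + 9 * X k * m ^ 2 - 144 * X k * X m - 36 * (X k) ^ 2 - 18 * X (E k) * s
    - 54 * X (X k) * m - 36 * X (X (X k)) + 9 * m * E m * s - 54 * E m * X s
    - 54 * X (E m) * s - 108 * X (X (X m))

variable {X E} {a b K L H G u₁ u₂ u₃ u₄ w₁ w₂ w₃ w₄ : R}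

/-- The coefficients up to the order `4` of an expansion `u = Φ⁻¹ (1 + u₁ Φ + ⋯)`,
`w = Φ⁻¹ (1 + w₁ Φ + ⋯)`, where `X Φ = 1` and `E Φ = 0`, of a solution of
`a E u + X² u - 2 u² w + H u + K X u = 0`, `b E w + X² w - 2 u w² + G w + L X w = 0`. -/
structure Recursion (X E : Derivation 𝕜 R R) (a K H u₁ u₂ u₃ u₄ w₁ w₂ w₃ w₄ : R) : Prop where
  one : -4 * u₁ - 2 * w₁ - K = 0
  two : H - 2 * (2 * u₂ + w₂ + u₁ ^ 2 + 2 * u₁ * w₁) = 0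
  three : 2 * u₃ + a * E u₁ + X (X u₁) + 2 * X u₂ + H * u₁ + K * (X u₁ + u₂)
    - 2 * (2 * u₃ + w₃ + 2 * u₁ * u₂ + w₁ * (2 * u₂ + u₁ ^ 2) + 2 * u₁ * w₂) = 0
  four : 6 * u₄ + a * E u₂ + X (X u₂) + 4 * X u₃ + H * u₂ + K * (X u₂ + 2 * u₃)
    - 2 * (2 * u₄ + w₄ + 2 * u₁ * u₃ + u₂ ^ 2 + w₁ * (2 * u₃ + 2 * u₁ * u₂)
      + w₂ * (2 * u₂ + u₁ ^ 2) + 2 * u₁ * w₃) = 0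

/-- At order 3 both equations contain the unknowns only as `-2 (u₃ + w₃)`, so their difference is
free of them. The orders 1 and 2 are used in reverse, to eliminate `K`, `L`, `H`, `G` in favour of
the lower coefficients; the claim is then a polynomial identity. -/
theorem Recursion.compatThree_eq_zero (hu : Recursion X E a K H u₁ u₂ u₃ u₄ w₁ w₂ w₃ w₄)
    (hw : Recursion X E b L G w₁ w₂ w₃ w₄ u₁ u₂ u₃ u₄) :
    compatThree X E (a + b) (a - b) (K + L) (K - L) (H - G) = 0 := by
  obtain ⟨h1, h2, h3, -⟩ := hu
  obtain ⟨k1, k2, k3, -⟩ := hw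
  obtain rfl : K = -4 * u₁ - 2 * w₁ := by linear_combination -h1
  obtain rfl : L = -4 * w₁ - 2 * u₁ := by linear_combination -k1
  obtain rfl : H = 2 * (2 * u₂ + w₂ + u₁ ^ 2 + 2 * u₁ * w₁) := by linear_combination h2
  obtain rfl : G = 2 * (2 * w₂ + u₂ + w₁ ^ 2 + 2 * w₁ * u₁) := by linear_combination k2
  simp only [compatThree, map_add, map_sub, map_neg, Derivation.leibniz, Derivation.leibniz_pow,
    Derivation.map_ofNat, smul_eq_mul, nsmul_eq_mul, mul_zero, add_zero,
    Nat.cast_ofNat, Nat.add_one_sub_one, pow_one, neg_mul]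
  linear_combination 12 * h3 - 12 * k3

/-- At order 4 the unknowns enter as `2 (u₄ - w₄)` with opposite signs, so the sum of the equations
is free of them. It still contains `4 X (u₃ + w₃)` and `-12 (u₁ + w₁) (u₃ + w₃)`, which are removed
by the order 3 equation and its `X`-derivative. -/
theorem Recursion.compatFour_eq_zero (hu : Recursion X E a K H u₁ u₂ u₃ u₄ w₁ w₂ w₃ w₄)
    (hw : Recursion X E b L G w₁ w₂ w₃ w₄ u₁ u₂ u₃ u₄) :
    compatFour X E (a + b) (a - b) (K + L) (K - L) (H + G) (H - G) = 0 := by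
  obtain ⟨h1, h2, h3, h4⟩ := hu
  obtain ⟨k1, k2, k3, k4⟩ := hw
  obtain rfl : K = -4 * u₁ - 2 * w₁ := by linear_combination -h1
  obtain rfl : L = -4 * w₁ - 2 * u₁ := by linear_combination -k1
  obtain rfl : H = 2 * (2 * u₂ + w₂ + u₁ ^ 2 + 2 * u₁ * w₁) := by linear_combination h2
  obtain rfl : G = 2 * (2 * w₂ + u₂ + w₁ ^ 2 + 2 * w₁ * u₁) := by linear_combination k2
  have h3x := congrArg X h3

  simp only [compatFour, map_add, map_sub, map_neg, Derivation.leibniz, Derivation.leibniz_pow,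
    Derivation.map_ofNat, smul_eq_mul, nsmul_eq_mul, mul_zero, add_zero,
    Nat.cast_ofNat, Nat.add_one_sub_one, pow_one, neg_mul, map_zero] at h3x ⊢
  linear_combination 216 * h4 + 216 * k4 + 432 * h3x
    - (216 * 6 * (u₁ + w₁)) * h3
end Compatibility

/-! ### Exponents, leading order and the scaling symmetry -/

section Expansion

variable {I J : Set ℝ} {f g h k : ℝ → ℝ → ℂ} {Φ : ℝ → ℝ → ℝ} {α β : ℤ} {u v : ℕ → ℝ → ℝ → ℂ}
  {x t : ℝ}

theorem laurent_of_lt {m : ℤ} (hm : m < α) : laurent α u m = 0 := if_neg hm.not_ge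

theorem formalDx_eq_zero {c : ℤ → ℝ → ℝ → ℂ} {m : ℤ} (h : c m = 0) (h' : c (m + 1) = 0) :
    formalDx Φ c m = 0 := by
  funext x t
  simp [formalDx, h, h', dx]

theorem formalDt_eq_zero {c : ℤ → ℝ → ℝ → ℂ} {m : ℤ} (h : c m = 0) (h' : c (m + 1) = 0) :
    formalDt Φ c m = 0 := by
  funext x t
  simp [formalDt, h, h', dt]

/-- The linear terms start at the power `α - 2`, which exceeds `2 α + β` under the hypothesis; only
the cubic term is left. -/
theorem substCoeff_lowest {σ : ℂ} (hαβ : α + β < -2) :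
    substCoeff σ f g h k Φ α β u v (2 * α + β) x t = g x t * (u 0 x t * u 0 x t * v 0 x t) := by
  have h0 : laurent α u (2 * α + β) = 0 := laurent_of_lt (by omega)
  have h1 : laurent α u (2 * α + β + 1) = 0 := laurent_of_lt (by omega)
  have h2 : laurent α u (2 * α + β + 1 + 1) = 0 := laurent_of_lt (by omega)
  have hx : formalDx Φ (laurent α u) (2 * α + β) = 0 := formalDx_eq_zero h0 h1
  have hx' : formalDx Φ (laurent α u) (2 * α + β + 1) = 0 := formalDx_eq_zero h1 h2
  simp only [substCoeff, formalDt_eq_zero h0 h1, hx, formalDx_eq_zero hx hx', h0]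
  simp [cubic]

theorem IsPainleveExpansion.exponents (H : IsPainleveExpansion I J f g h k Φ α β u v)
    (hα : α < 0) (hβ : β < 0) (hx : x ∈ I) (ht : t ∈ J) (hg : g x t ≠ 0) : α = -1 ∧ β = -1 := by
  by_cases hαβ : α + β < -2
  · have := H.eq_u (2 * α + β) x hx t ht
    rw [substCoeff_lowest hαβ] at this
    simp [hg, H.leading_u x hx t ht, H.leading_v x hx t ht] at this
  · omega

theorem dx_const_mul (c : ℂ) (F : ℝ → ℝ → ℂ) :
    dx (fun x t => c * F x t) = fun x t => c * dx F x t := by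
  funext x t
  exact deriv_const_mul_field c

theorem dt_const_mul (c : ℂ) (F : ℝ → ℝ → ℂ) :
    dt (fun x t => c * F x t) = fun x t => c * dt F x t := by
  funext x t
  exact deriv_const_mul_field c

theorem formalDx_const_mul (c : ℂ) (d : ℤ → ℝ → ℝ → ℂ) :
    formalDx Φ (fun m x t => c * d m x t) = fun m x t => c * formalDx Φ d m x t := by
  funext m x t
  simp only [formalDx, dx_const_mul]
  ring

theorem formalDt_const_mul (c : ℂ) (d : ℤ → ℝ → ℝ → ℂ) :
    formalDt Φ (fun m x t => c * d m x t) = fun m x t => c * formalDt Φ d m x t := by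
  funext m x t
  simp only [formalDt, dt_const_mul]
  ring

theorem laurent_const_mul (c : ℂ) :
    laurent α (fun j x t => c * u j x t) = fun m x t => c * laurent α u m x t := by
  funext m x t
  by_cases hm : α ≤ m <;> simp [laurent, hm]

theorem cubic_const_mul {c : ℂ} (hc : c ≠ 0) (m : ℤ) :
    cubic α β (fun j x t => c * u j x t) (fun j x t => c⁻¹ * v j x t) m x t =
      c * cubic α β u v m x t := by
  by_cases hm : 2 * α + β ≤ m
  · simp only [cubic, hm, if_true, Finset.mul_sum, Finset.sum_mul]
    refine Finset.sum_congr rfl fun p _ => Finset.sum_congr rfl fun q _ => ?_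
    field_simp
  · simp [cubic, hm]

theorem substCoeff_const_mul {σ c : ℂ} (hc : c ≠ 0) (m : ℤ) :
    substCoeff σ f g h k Φ α β (fun j x t => c * u j x t) (fun j x t => c⁻¹ * v j x t) m x t =
      c * substCoeff σ f g h k Φ α β u v m x t := by
  simp only [substCoeff, laurent_const_mul, formalDx_const_mul, formalDt_const_mul,
    cubic_const_mul hc]
  ring

theorem RealAnalyticOn.const_mul {F : ℝ → ℝ → ℂ} (hF : RealAnalyticOn I J F) (c : ℂ) :
    RealAnalyticOn I J fun x t => c * F x t := fun p hp =>
  (analyticAt_const (v := c)).mul (hF p hp)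

/-- The gauge symmetry of the system with `u` and `v` independent: it rules out free places that
avoid both leading coefficients. -/
theorem IsPainleveExpansion.const_mul (H : IsPainleveExpansion I J f g h k Φ α β u v) {c : ℂ}
    (hc : c ≠ 0) :
    IsPainleveExpansion I J f g h k Φ α β (fun j x t => c * u j x t)
      (fun j x t => c⁻¹ * v j x t) where
  analytic_u j := (H.analytic_u j).const_mul c
  analytic_v j := (H.analytic_v j).const_mul c⁻¹
  leading_u x hx t ht := mul_ne_zero hc (H.leading_u x hx t ht)
  leading_v x hx t ht := mul_ne_zero (inv_ne_zero hc) (H.leading_v x hx t ht)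
  eq_u m x hx t ht := by rw [substCoeff_const_mul hc, H.eq_u m x hx t ht, mul_zero]
  eq_v m x hx t ht := by
    have := substCoeff_const_mul (f := cconj f) (g := cconj g) (h := cconj h) (k := cconj k)
      (Φ := Φ) (α := β) (β := α) (u := v) (v := u) (x := x) (t := t) (σ := -Complex.I)
      (inv_ne_zero hc) m
    rw [inv_inv] at this
    rw [this, H.eq_v m x hx t ht, mul_zero]

theorem substCoeff_leading {σ : ℂ} :
    substCoeff σ f g h k Φ (-1) (-1) u v (-3) x t =
      u 0 x t * (2 * f x t * ((dx Φ x t : ℝ) : ℂ) ^ 2 + g x t * (u 0 x t * v 0 x t)) := by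
  have h3 : laurent (-1) u (-3) = 0 := laurent_of_lt (by omega)
  have h2 : laurent (-1) u (-2) = 0 := laurent_of_lt (by omega)
  have h1 : laurent (-1) u (-1) = u 0 := by simp [laurent]
  have hx : formalDx Φ (laurent (-1) u) (-3) = 0 := formalDx_eq_zero h3 h2
  have ht : formalDt Φ (laurent (-1) u) (-3) = 0 := formalDt_eq_zero h3 h2
  have hx' : formalDx Φ (laurent (-1) u) (-2) = fun x t => -(((dx Φ x t : ℝ) : ℂ) * u 0 x t) := by
    funext x t
    simp [formalDx, h2, h1, dx]
    ring
  have hc : cubic (-1) (-1) u v (-3) x t = u 0 x t * u 0 x t * v 0 x t := by simp [cubic]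
  simp only [substCoeff, ht, hx, h3, hc]
  rw [formalDx, hx]
  norm_num [hx', dx]
  ring

theorem IsPainleveExpansion.leading (H : IsPainleveExpansion I J f g h k Φ (-1) (-1) u v)
    (hx : x ∈ I) (ht : t ∈ J) :
    2 * f x t * ((dx Φ x t : ℝ) : ℂ) ^ 2 + g x t * (u 0 x t * v 0 x t) = 0 := by
  have := H.eq_u (-3) x hx t ht
  rw [substCoeff_leading] at this
  exact (mul_eq_zero.1 this).resolve_left (H.leading_u x hx t ht)

/-- If the Painlevé test is passed, there is an expansion with leading coefficient `u₀ = 1`. -/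
theorem PassesPainleveTest.exists_expansion (H : PassesPainleveTest I J f g h k)
    (hg : ∀ x ∈ I, ∀ t ∈ J, g x t ≠ 0) (hI : I.Nonempty) (hJ : J.Nonempty)
    (hΦ : RealAnalyticOn I J Φ) (hΦx : ∀ x ∈ I, ∀ t ∈ J, dx Φ x t ≠ 0) :
    ∃ u v, IsPainleveExpansion I J f g h k Φ (-1) (-1) u v ∧
      ∀ x ∈ I, ∀ t ∈ J, u 0 x t = 1 := by
  obtain ⟨x₀, hx₀⟩ := hI
  obtain ⟨t₀, ht₀⟩ := hJ
  obtain ⟨α, β, hα, hβ, S, -, hS⟩ := H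
  replace hS := hS Φ hΦ hΦx
  have hone : RealAnalyticOn I J fun _ _ => (1 : ℂ) := fun p _ => analyticAt_const
  obtain ⟨⟨u₁, v₁, hu₁, h1⟩, -⟩ := hS (fun _ _ _ => 1) (fun _ _ => hone)
    fun _ _ _ _ _ _ _ => one_ne_zero
  obtain ⟨rfl, rfl⟩ := hu₁.exponents hα hβ hx₀ ht₀ (hg x₀ hx₀ t₀ ht₀)
  by_cases hl : Sum.inl 0 ∈ S
  · exact ⟨u₁, v₁, hu₁, h1 _ hl⟩
  -- If `v₀` is the free place, the leading order fixes the product `u₀ v₀`. The first expansion has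
  -- `v₀ = 1`, so prescribing its `u₀` as the new `v₀` makes the new `u₀` equal to `1`.
  by_cases hr : Sum.inr 0 ∈ S
  · obtain ⟨⟨u₂, v₂, hu₂, h2⟩, -⟩ := hS (fun s => if s = Sum.inr 0 then u₁ 0 else fun _ _ => 1)
      (fun s _ => by
        by_cases hs : s = Sum.inr 0
        · simpa [hs] using hu₁.analytic_u 0
        · simpa [hs] using hone)
      (fun s _ _ x hx t ht => by
        by_cases hs : s = Sum.inr 0
        · simpa [hs] using hu₁.leading_u x hx t ht
        · simp [hs])
    refine ⟨u₂, v₂, hu₂, fun x hx t ht => ?_⟩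
    have e1 := hu₁.leading hx ht
    have e2 := hu₂.leading hx ht
    have e3 : v₁ 0 x t = 1 := h1 _ hr x hx t ht
    have e4 : v₂ 0 x t = u₁ 0 x t := by simpa using h2 _ hr x hx t ht
    rw [e3] at e1
    rw [e4] at e2
    refine mul_left_cancel₀ (mul_ne_zero (hg x hx t ht) (hu₁.leading_u x hx t ht)) ?_
    linear_combination e2 - e1
  -- With zero data at all places of `S`, doubling `u` and halving `v` respects the data but changes
  -- `u₀`, against uniqueness.
  · exfalso
    obtain ⟨⟨u₂, v₂, hu₂, h2⟩, huniq⟩ := hS (fun _ _ _ => 0) (fun _ _ _ _ => analyticAt_const) (by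
      rintro s hs (rfl | rfl)
      · exact absurd hs hl
      · exact absurd hs hr)
    have := (huniq _ _ _ _ hu₂ (hu₂.const_mul two_ne_zero) h2 (by
      rintro (j | j) hs x hx t ht
      · have e : u₂ j x t = 0 := h2 _ hs x hx t ht
        simp [e]
      · have e : v₂ j x t = 0 := h2 _ hs x hx t ht
        simp [e]) 0 x₀ hx₀ t₀ ht₀).1
    exact hu₂.leading_u x₀ hx₀ t₀ ht₀ (by linear_combination -this)

end Expansion

/-! ### Formal expansions over a differential ring -/

section RingExpansion

open TopologicalSpace SmoothRing

variable {𝕜 R : Type*} [CommRing 𝕜] [CommRing R] [Algebra 𝕜 R]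

/-- The coefficients of an expansion `∑ⱼ Uⱼ Φ^(j - 1)`. -/
def laurentRing (U : ℕ → R) (m : ℤ) : R := if -1 ≤ m then U (m + 1).toNat else 0

/-- The coefficients of `u² v`. -/
def cubicRing (U V : ℕ → R) (m : ℤ) : R :=
  if -3 ≤ m then
    ∑ p ∈ Finset.HasAntidiagonal.antidiagonal (m + 3).toNat,
      (∑ q ∈ Finset.HasAntidiagonal.antidiagonal p.1, U q.1 * U q.2) * V p.2
  else 0

/-- The coefficients of `X u`, where `p = X Φ`. -/
def diffRing (X : Derivation 𝕜 R R) (p : R) (c : ℤ → R) (m : ℤ) : R :=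
  X (c m) + ((m : R) + 1) * p * c (m + 1)

/-- The coefficients of `σ T u + f X² u + g u² v + h u + k X u`, where `p = X Φ`, `q = T Φ`. -/
def substRing (X T : Derivation 𝕜 R R) (σ f g h k p q : R) (U V : ℕ → R) (m : ℤ) : R :=
  σ * diffRing T q (laurentRing U) m + f * diffRing X p (diffRing X p (laurentRing U)) m
    + g * cubicRing U V m + h * laurentRing U m + k * diffRing X p (laurentRing U) m

variable {I J : Opens ℝ}

theorem SmoothRing.rep_intCast_add_one (m : ℤ) :
    Rep (fun _ _ => (m : ℂ) + 1) ((m : SmoothRing ℂ I J) + 1) :=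
  ⟨contDiffOn_const, fun p => by simp⟩

theorem SmoothRing.Rep.formalDx {c : ℤ → ℝ → ℝ → ℂ} {C : ℤ → SmoothRing ℂ I J}
    (hc : ∀ m, Rep (c m) (C m)) {Φ : ℝ → ℝ → ℝ} {p : SmoothRing ℂ I J}
    (hp : Rep (fun x t => ((VCNLS.dx Φ x t : ℝ) : ℂ)) p) (m : ℤ) :
    Rep (formalDx Φ c m) (diffRing (X ℂ I J) p C m) :=
  (hc m).dx.add (((rep_intCast_add_one m).mul hp).mul (hc (m + 1)))

theorem SmoothRing.Rep.formalDt {c : ℤ → ℝ → ℝ → ℂ} {C : ℤ → SmoothRing ℂ I J}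
    (hc : ∀ m, Rep (c m) (C m)) {Φ : ℝ → ℝ → ℝ} {q : SmoothRing ℂ I J}
    (hq : Rep (fun x t => ((VCNLS.dt Φ x t : ℝ) : ℂ)) q) (m : ℤ) :
    Rep (formalDt Φ c m) (diffRing (T ℂ I J) q C m) :=
  (hc m).dt.add (((rep_intCast_add_one m).mul hq).mul (hc (m + 1)))

variable {u v : ℕ → ℝ → ℝ → ℂ} {U V : ℕ → SmoothRing ℂ I J}

theorem SmoothRing.rep_laurent (hu : ∀ j, Rep (u j) (U j)) (m : ℤ) :
    Rep (laurent (-1) u m) (laurentRing U m) := by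
  by_cases hm : -1 ≤ m
  · simpa [laurent, laurentRing, hm] using hu _
  · simp only [laurent, laurentRing, hm, if_false]
    exact rep_zero

theorem SmoothRing.rep_cubic (hu : ∀ j, Rep (u j) (U j)) (hv : ∀ j, Rep (v j) (V j)) (m : ℤ) :
    Rep (cubic (-1) (-1) u v m) (cubicRing U V m) := by
  by_cases hm : -3 ≤ m
  · have := Rep.sum (s := Finset.HasAntidiagonal.antidiagonal (m + 3).toNat) fun p : ℕ × ℕ =>
      (Rep.sum (s := Finset.HasAntidiagonal.antidiagonal p.1) fun q : ℕ × ℕ =>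
        (hu q.1).mul (hu q.2)).mul (hv p.2)
    unfold cubic cubicRing
    norm_num [hm]
    exact this
  · unfold cubic cubicRing
    norm_num [hm]
    exact rep_zero

theorem SmoothRing.rep_substCoeff {f g h k : ℝ → ℝ → ℂ} {f' g' h' k' p q : SmoothRing ℂ I J}
    (hf : Rep f f') (hg : Rep g g') (hh : Rep h h') (hk : Rep k k') {Φ : ℝ → ℝ → ℝ}
    (hp : Rep (fun x t => ((dx Φ x t : ℝ) : ℂ)) p) (hq : Rep (fun x t => ((dt Φ x t : ℝ) : ℂ)) q)
    (hu : ∀ j, Rep (u j) (U j)) (hv : ∀ j, Rep (v j) (V j)) (σ : ℂ) (m : ℤ) :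
    Rep (substCoeff σ f g h k Φ (-1) (-1) u v m)
      (substRing (X ℂ I J) (T ℂ I J) (algebraMap ℂ _ σ) f' g' h' k' p q U V m) :=
  (((((rep_algebraMap σ).mul (Rep.formalDt (rep_laurent hu) hq m)).add
    (hf.mul (Rep.formalDx (Rep.formalDx (rep_laurent hu) hp) hp m))).add
    (hg.mul (rep_cubic hu hv m))).add (hh.mul (rep_laurent hu m))).add
    (hk.mul (Rep.formalDx (rep_laurent hu) hp m))

end RingExpansion

/-! ### Reduction to the normal form -/

section Normalisation

variable {𝕜 R : Type*} [CommRing 𝕜] [CommRing R] [Algebra 𝕜 R]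
  {X T Y E : Derivation 𝕜 R R} {σ f g h k p q : R} {U V : ℕ → R}

/-- In terms of the derivations `Y = p⁻¹ X`, `E = T - q Y` and of the rescaled coefficients
`U / s₁`, `V / s₂` the coefficient equations take the normal form. -/
theorem recursion_of_substRing (H : ∀ m, substRing X T σ f g h k p q U V m = 0)
    {a π κ η s₁ s₂ ν ε : R} {u v : ℕ → R}
    (hX : ∀ φ, X φ = p * Y φ) (hT : ∀ φ, T φ = E φ + q * Y φ) (hYp : Y p = p * π)
    (hσ : σ = f * p ^ 2 * a) (hk : k = f * p * κ) (hh : h = f * p ^ 2 * η)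
    (hg : g * s₁ * s₂ = -2 * f * p ^ 2) (hYs : Y s₁ = s₁ * ν) (hEs : E s₁ = s₁ * ε)
    (hf : IsUnit f) (hp : IsUnit p) (hs : IsUnit s₁)
    (hU : ∀ j, U j = s₁ * u j) (hV : ∀ j, V j = s₂ * v j) (hu : u 0 = 1) (hv : v 0 = 1) :
    Recursion Y E a (π + κ + a * q + 2 * ν)
      (η + a * ε + Y ν + ν ^ 2 + (π + κ + a * q) * ν)
      (u 1) (u 2) (u 3) (u 4) (v 1) (v 2) (v 3) (v 4) := by
  have e1 := H (-2)
  have e2 := H (-1)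
  have e3 := H 0
  have e4 := H 1
  have hunit : IsUnit (f * p ^ 2 * s₁) := (hf.mul (hp.pow 2)).mul hs
  have hY1 : Y (1 : R) = 0 := Y.map_one_eq_zero
  simp [substRing, diffRing, laurentRing, cubicRing, Finset.Nat.antidiagonal_succ, hX, hT, hYp,
    hU, hV, hu, hv, hYs, hEs, hY1, hσ, hk, hh, Derivation.map_ofNat] at e1 e2 e3 e4
  -- The substituted equations are `f p² s₁` times those of the normal form. The relation `hg` turns
  -- the cubic coefficient into `-2`; each multiple of it below is the cubic convolution at the
  -- order in question.
  constructor <;> refine hunit.mul_left_cancel ?_ <;> rw [mul_zero]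
  · linear_combination e1 - (2 * s₁ * u 1 + s₁ * v 1) * hg
  · linear_combination e2 - s₁ * (2 * u 2 + v 2 + u 1 ^ 2 + 2 * u 1 * v 1) * hg
  · linear_combination e3 - s₁ * (2 * u 3 + v 3 + 2 * u 1 * u 2 + v 1 * (2 * u 2 + u 1 ^ 2)
      + 2 * u 1 * v 2) * hg
  · linear_combination e4 - s₁ * (2 * u 4 + v 4 + 2 * u 1 * u 3 + u 2 ^ 2
      + v 1 * (2 * u 3 + 2 * u 1 * u 2) + v 2 * (2 * u 2 + u 1 ^ 2) + 2 * u 1 * v 3) * hg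

end Normalisation

/-! ### Finite differences in the parameter `c` of `Φ` -/

section Family

variable {𝕜 R : Type*} [CommRing 𝕜] [CommRing R] [Algebra 𝕜 R]
  {Y T : Derivation 𝕜 R R} {s d k m S D : R}

/-- The only cubic contribution in `c` comes from `-k² m`, namely `-s² d c³`; a third difference
over `-2, -1, 1, 2` extracts it. -/
theorem mul_sq_eq_zero_of_compatThree
    (h : ∀ c : ℤ, compatThree Y (T - (c : R) • Y) s d (k + c * s) (m + c * d) D = 0) :
    12 * (d * s ^ 2) = 0 := by
  have h2 := h 2
  have h1 := h 1
  have h1' := h (-1)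
  have h2' := h (-2)
  simp only [compatThree, map_add, map_neg, Derivation.leibniz,
    smul_eq_mul, mul_zero, add_zero, Derivation.sub_apply, Derivation.smul_apply, Int.cast_ofNat,
    Int.cast_neg, Int.cast_one, Derivation.map_ofNat, Derivation.map_one_eq_zero, neg_zero]
    at h2 h1 h1' h2'
  linear_combination -h2 + 2 * h1 - 2 * h1' + h2'

/-- The fourth difference in `c` is `24` times the coefficient of `c⁴`, which comes from `9 k² m² -
9 k³ m - 2 k⁴`. -/
theorem mul_cube_eq_zero_of_compatFour
    (h : ∀ c : ℤ, compatFour Y (T - (c : R) • Y) s d (k + c * s) (m + c * d) S D = 0) :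
    24 * (-9 * d * s ^ 3 + 9 * d ^ 2 * s ^ 2 - 2 * s ^ 4) = 0 := by
  have h2 := h 2
  have h1 := h 1
  have h0 := h 0
  have h1' := h (-1)
  have h2' := h (-2)
  simp only [compatFour, map_add, map_sub, map_neg, Derivation.leibniz,
    smul_eq_mul, mul_zero, add_zero, zero_mul, sub_zero, Derivation.sub_apply,
    Derivation.smul_apply, Int.cast_ofNat, Int.cast_neg, Int.cast_one, Int.cast_zero,
    Derivation.map_ofNat, Derivation.map_one_eq_zero, neg_zero] at h2 h1 h0 h1' h2'
  linear_combination h2 - 4 * h1 + 6 * h0 - 4 * h1' + h2'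

/-- Once `s = 0`, the second difference of the order 4 condition still involves `T d` and second
derivatives of `d`; adding `9 d` times the first difference of the order 3 condition leaves a
product of two first-order factors. -/
theorem deriv_mul_eq_zero_of_compat
    (h : ∀ c : ℤ, compatThree Y (T - (c : R) • Y) 0 d k (m + c * d) D = 0)
    (h' : ∀ c : ℤ, compatFour Y (T - (c : R) • Y) 0 d k (m + c * d) S D = 0) :
    36 * (Y d * (d * k + 3 * Y d)) = 0 := by
  have h1 := h 1
  have h1' := h (-1)
  have k1 := h' 1
  have k0 := h' 0
  have k1' := h' (-1)
  simp only [compatThree, compatFour, map_add, map_sub, map_neg, Derivation.leibniz,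
    smul_eq_mul, mul_zero, add_zero, zero_mul, sub_zero, Derivation.sub_apply,
    Derivation.smul_apply, Int.cast_neg, Int.cast_one, Int.cast_zero, map_zero,
    Derivation.map_one_eq_zero, neg_zero] at h1 h1' k1 k0 k1'
  linear_combination k1 - 2 * k0 + k1' + 9 * d * (h1 - h1')

end Family

/-! ### Both conditions in terms of the original coefficients -/

section Abstract

variable {𝕜 R : Type*} [CommRing 𝕜] [CommRing R] [Algebra 𝕜 R] {X T Y : Derivation 𝕜 R R}
  {f fb g gb h hb k kb fi fbi gi p q P i a b π κ κb ρ τ ν : R} {U V : ℕ → R}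

/-- The compatibility conditions at the resonances `3` and `4` for an expansion with `U 0 = 1` in
powers of `Φ`, where `Φ_t = q` and `Φ_x = p` does not depend on `t`. -/
theorem compat_of_substRing
    (Hu : ∀ m, substRing X T i f g h k p q U V m = 0)
    (Hv : ∀ m, substRing X T (-i) fb gb hb kb p q V U m = 0) (hU0 : U 0 = 1)
    (h2u : IsUnit (2 : R)) (hfi : f * fi = 1) (hfbi : fb * fbi = 1) (hgi : g * gi = 1)
    (hpP : p * P = 1) (hTp : T p = 0) (hY : Y = P • X)
    (ha : a = i * fi * P ^ 2) (hb' : b = -i * fbi * P ^ 2)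
    (hπ : π = P * Y p) (hκ : κ = k * fi * P) (hκb : κb = kb * fbi * P)
    (hρ : ρ = fi * X f - gi * X g) (hτ : τ = fi * T f - gi * T g)
    (hν : ν = 2 * π + P * ρ) :
    fb * g = f * gb ∧
    compatThree Y (T - q • Y) (a + b) (a - b)
      (2 * π + κ + κb + 2 * ν + q * (a + b)) (κ - κb - 2 * ν + q * (a - b))
      (h * fi * P ^ 2 - (hb * fbi * P ^ 2 + b * τ + Y ν + ν ^ 2 + (π + κb) * ν)) = 0 ∧
    compatFour Y (T - q • Y) (a + b) (a - b)
      (2 * π + κ + κb + 2 * ν + q * (a + b)) (κ - κb - 2 * ν + q * (a - b))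
      (h * fi * P ^ 2 + (hb * fbi * P ^ 2 + b * τ + Y ν + ν ^ 2 + (π + κb) * ν))
      (h * fi * P ^ 2 - (hb * fbi * P ^ 2 + b * τ + Y ν + ν ^ 2 + (π + κb) * ν)) = 0 := by
  -- Since `U 0 = 1`, the leading order makes `s = -2 f p² / g` the leading coefficient of `v`. The
  -- conjugate equation gives the same product with `f` and `g` conjugated; comparison yields the
  -- first conclusion.
  obtain ⟨s, hs⟩ : ∃ s, s = p ^ 2 * (-2 * f * gi) := ⟨_, rfl⟩
  have hV0 : V 0 = s := by
    have := Hu (-3)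
    simp [substRing, diffRing, laurentRing, cubicRing, hU0] at this
    linear_combination gi * this - V 0 * hgi - hs
  have hfu : IsUnit f := IsUnit.of_mul_eq_one _ hfi
  have hpu : IsUnit p := IsUnit.of_mul_eq_one _ hpP
  have hsu : IsUnit s := hs ▸ (hpu.pow 2).mul ((h2u.neg.mul hfu).mul
    (IsUnit.of_mul_eq_one g (by rw [mul_comm, hgi])))
  have hgbs : gb * s = -2 * fb * p ^ 2 := by
    have := Hv (-3)
    simp [substRing, diffRing, laurentRing, cubicRing, hU0, hV0] at this
    refine hsu.mul_left_cancel ?_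
    linear_combination this
  have hXi : X gi = -gi ^ 2 * X g :=
    (X).leibniz_of_mul_eq_one (by rw [mul_comm, hgi])
  have hTi : T gi = -gi ^ 2 * T g :=
    (T).leibniz_of_mul_eq_one (by rw [mul_comm, hgi])
  have hXY : ∀ φ, X φ = p * Y φ := fun φ => by
    simp only [hY, Derivation.smul_apply, smul_eq_mul]
    linear_combination -X φ * hpP
  have hTE : ∀ φ, T φ = (T - q • Y) φ + q * Y φ := fun φ => by
    simp only [Derivation.sub_apply, Derivation.smul_apply, smul_eq_mul]
    ring
  have hYp : Y p = p * π := by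
    rw [hπ]
    linear_combination -Y p * hpP
  have hXs : X s = s * (2 * p * π + ρ) := by
    have hXp := hXY p
    simp only [hs, Derivation.leibniz, Derivation.leibniz_pow, smul_eq_mul, hXi, hXp, hYp, map_neg,
      Derivation.map_ofNat, hρ, nsmul_eq_mul, Nat.add_one_sub_one, pow_one, Nat.cast_ofNat]
    linear_combination 2 * p ^ 2 * gi * X f * hfi
  have hTs : T s = s * τ := by
    simp only [hs, Derivation.leibniz, Derivation.leibniz_pow, smul_eq_mul, hTi, hTp, map_neg,
      Derivation.map_ofNat, hτ, nsmul_eq_mul, Nat.add_one_sub_one, pow_one, Nat.cast_ofNat]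
    linear_combination 2 * p ^ 2 * gi * T f * hfi
  have hYs : Y s = s * ν := by
    refine hpu.mul_left_cancel ?_
    rw [← hXY, hXs, hν]
    linear_combination -s * ρ * hpP
  have hEs : (T - q • Y) s = s * (τ - q * ν) := by
    have := hTE s
    rw [hTs, hYs] at this
    linear_combination -this
  obtain ⟨si, hsi⟩ := hsu.exists_right_inv
  have hPp : ∀ e e' : R, e' * e = 1 → ∀ z, z = e' * p ^ 2 * (z * e * P ^ 2) :=
    fun e e' he z => by
      linear_combination -z * he - z * e * e' * (p * P + 1) * hpP
  have hkp : ∀ e e' : R, e' * e = 1 → ∀ z, z = e' * p * (z * e * P) :=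
    fun e e' he z => by
      linear_combination -z * he - z * e * e' * hpP
  -- Only `v` is rescaled, by `s`; hence the logarithmic derivatives `ν` and `τ - q ν` of `s` appear
  -- in the second recursion alone.
  have Ru := recursion_of_substRing Hu hXY hTE hYp (a := a) (κ := κ) (η := h * fi * P ^ 2)
    (s₁ := 1) (s₂ := s) (ν := 0) (ε := 0) (u := U) (v := fun j => si * V j)
    (ha ▸ hPp _ _ hfi i) (hκ ▸ hkp _ _ hfi k) (hPp _ _ hfi h)
    (by rw [hs]; linear_combination -2 * f * p ^ 2 * hgi) (by simp) (by simp) hfu hpu isUnit_one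
    (by simp) (fun j => by linear_combination -V j * hsi) hU0
    (by rw [hV0]; linear_combination hsi)
  have Rv := recursion_of_substRing Hv hXY hTE hYp (a := b) (κ := κb) (η := hb * fbi * P ^ 2)
    (s₁ := s) (s₂ := 1) (ν := ν) (ε := τ - q * ν) (u := fun j => si * V j) (v := U)
    (hb' ▸ hPp _ _ hfbi (-i)) (hκb ▸ hkp _ _ hfbi kb) (hPp _ _ hfbi hb)
    (by rw [mul_one, hgbs]) hYs hEs (IsUnit.of_mul_eq_one _ hfbi) hpu hsu
    (fun j => by linear_combination -V j * hsi) (by simp)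
    (by rw [hV0]; linear_combination hsi) hU0
  simp only [mul_zero, add_zero, map_zero, zero_pow two_ne_zero] at Ru
  have ek : 2 * π + κ + κb + 2 * ν + q * (a + b) =
      π + κ + a * q + (π + κb + b * q + 2 * ν) := by ring
  have em : κ - κb - 2 * ν + q * (a - b) =
      π + κ + a * q - (π + κb + b * q + 2 * ν) := by ring
  have eG : hb * fbi * P ^ 2 + b * τ + Y ν + ν ^ 2 + (π + κb) * ν =
      hb * fbi * P ^ 2 + b * (τ - q * ν) + Y ν + ν ^ 2 + (π + κb + b * q) * ν := by ring
  rw [ek, em, eG]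
  refine ⟨?_, ?_, ?_⟩
  · refine (h2u.mul (hpu.pow 2)).mul_left_cancel ?_
    rw [hs] at hgbs
    linear_combination g * hgbs + 2 * f * gb * p ^ 2 * hgi
  · exact Ru.compatThree_eq_zero Rv
  · exact Ru.compatFour_eq_zero Rv

end Abstract

/-! ### From the Painlevé test to the differential ring -/

section Test

open TopologicalSpace SmoothRing

variable {I J : Opens ℝ}

theorem RealAnalyticOn.smoothOn {E : Type*} [NormedAddCommGroup E] [NormedSpace ℝ E]
    [CompleteSpace E] {F : ℝ → ℝ → E} (hF : RealAnalyticOn I J F) : SmoothOn I J F :=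
  fun p hp => (hF p hp).contDiffAt.contDiffWithinAt

theorem SmoothRing.isUnit_two : IsUnit (2 : SmoothRing ℂ I J) := by
  obtain ⟨ψ, hψ⟩ := exists_mul_eq_one (2 : SmoothRing ℂ I J) fun p => by
    rw [map_ofNat]
    exact two_ne_zero
  exact IsUnit.of_mul_eq_one ψ hψ

/-- The compatibility conditions at the resonances `3` and `4` for an expansion in powers of `Φ`,
where `Φ_t = q` and `Φ_x = p` does not depend on `t`. -/
theorem compat_of_passesPainleveTest {f g h k : ℝ → ℝ → ℂ}
    {f' fb g' gb h' hb k' kb fi fbi gi : SmoothRing ℂ I J}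
    (hf : Rep f f') (hfb : Rep (cconj f) fb) (hg : Rep g g') (hgb : Rep (cconj g) gb)
    (hh : Rep h h') (hhb : Rep (cconj h) hb) (hk : Rep k k') (hkb : Rep (cconj k) kb)
    (hfi : f' * fi = 1) (hfbi : fb * fbi = 1) (hgi : g' * gi = 1)
    (hI : (I : Set ℝ).Nonempty) (hJ : (J : Set ℝ).Nonempty) (H : PassesPainleveTest I J f g h k)
    {Φ : ℝ → ℝ → ℝ} (hΦ : RealAnalyticOn I J Φ) (hΦx : ∀ x ∈ I, ∀ t ∈ J, dx Φ x t ≠ 0)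
    {p q P i a b π κ κb ρ τ ν : SmoothRing ℂ I J}
    {Y : Derivation ℂ (SmoothRing ℂ I J) (SmoothRing ℂ I J)}
    (hp : Rep (fun x t => ((dx Φ x t : ℝ) : ℂ)) p) (hq : Rep (fun x t => ((dt Φ x t : ℝ) : ℂ)) q)
    (hpP : p * P = 1) (hTp : T ℂ I J p = 0) (hi : i = algebraMap ℂ _ Complex.I)
    (hY : Y = P • X ℂ I J) (ha : a = i * fi * P ^ 2) (hb' : b = -i * fbi * P ^ 2)
    (hπ : π = P * Y p) (hκ : κ = k' * fi * P) (hκb : κb = kb * fbi * P)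
    (hρ : ρ = fi * X ℂ I J f' - gi * X ℂ I J g') (hτ : τ = fi * T ℂ I J f' - gi * T ℂ I J g')
    (hν : ν = 2 * π + P * ρ) :
    fb * g' = f' * gb ∧
    compatThree Y (T ℂ I J - q • Y) (a + b) (a - b)
      (2 * π + κ + κb + 2 * ν + q * (a + b)) (κ - κb - 2 * ν + q * (a - b))
      (h' * fi * P ^ 2 - (hb * fbi * P ^ 2 + b * τ + Y ν + ν ^ 2 + (π + κb) * ν)) = 0 ∧
    compatFour Y (T ℂ I J - q • Y) (a + b) (a - b)
      (2 * π + κ + κb + 2 * ν + q * (a + b)) (κ - κb - 2 * ν + q * (a - b))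
      (h' * fi * P ^ 2 + (hb * fbi * P ^ 2 + b * τ + Y ν + ν ^ 2 + (π + κb) * ν))
      (h' * fi * P ^ 2 - (hb * fbi * P ^ 2 + b * τ + Y ν + ν ^ 2 + (π + κb) * ν)) = 0 := by
  have hg0 : ∀ x ∈ I, ∀ t ∈ J, g x t ≠ 0 := fun x hx t ht h0 => by
    have := congrArg (ev ⟨(x, t), hx, ht⟩) hgi
    rw [map_mul, ← hg.apply hx ht, h0] at this
    simp at this
  obtain ⟨u, v, huv, hu0⟩ := H.exists_expansion hg0 hI hJ hΦ hΦx
  obtain ⟨U, hu⟩ : ∃ U : ℕ → SmoothRing ℂ I J, ∀ j, Rep (u j) (U j) :=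
    ⟨_, fun j => rep_toRing (huv.analytic_u j).smoothOn⟩
  obtain ⟨V, hv⟩ : ∃ V : ℕ → SmoothRing ℂ I J, ∀ j, Rep (v j) (V j) :=
    ⟨_, fun j => rep_toRing (huv.analytic_v j).smoothOn⟩
  have Hu : ∀ m, substRing (X ℂ I J) (T ℂ I J) i f' g' h' k' p q U V m = 0 := fun m =>
    hi ▸ (rep_substCoeff hf hg hh hk hp hq hu hv Complex.I m).eq_zero (huv.eq_u m)
  have Hv : ∀ m, substRing (X ℂ I J) (T ℂ I J) (-i) fb gb hb kb p q V U m = 0 := fun m => by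
    have := (rep_substCoeff hfb hgb hhb hkb hp hq hv hu (-Complex.I) m).eq_zero (huv.eq_v m)
    rwa [map_neg, ← hi] at this
  have hU0 : U 0 = 1 := (hu 0).eq (rep_one.congr hu0)
  exact compat_of_substRing Hu Hv hU0 isUnit_two hfi hfbi hgi hpP hTp hY ha hb' hπ hκ hκb hρ hτ hν

end Test

/-! ### The two conditions for real `f`, `g` and `Φ = x` -/

section Resonance

variable {𝕜 R : Type*} [CommRing 𝕜] [CommRing R] [Algebra 𝕜 R] {X T : Derivation 𝕜 R R}
  {f n g y z k₂ h₁ Γ i half ρ τ κ κb η ηb : R}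

/-- The right-hand side of the equation for `h₁` as a rational function of the partial
derivatives of `f`, `g`, `k₂` and of `γ` and its derivative `γ'`. -/
def potentialJet {K : Type*} [Field K] (γ γ' F Fx Fxx Fxxx Ft Ftt Fxt G Gx Gxx Gxxx Gxxxx
    k kx kxx kt kxt : K) : K :=
  4 * γ ^ 2 + 2 * γ' - 3 * Ft ^ 2 / (4 * F ^ 2) + Ftt / (2 * F)
    - 3 * k * Ft * Fx / (2 * F ^ 2) + kt * Fx / (2 * F) - 3 * k ^ 2 * Fx ^ 2 / (4 * F ^ 2)
    + kx * Ft / F + 3 * k * kx * Fx / (2 * F) - kx ^ 2 + k * Fxt / F - kxt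
    + k ^ 2 * Fxx / (2 * F) - k * kxx
    - Fx ^ 2 * Gx ^ 2 / (2 * G ^ 2) + 7 * F * Fx * Gx ^ 3 / (2 * G ^ 3)
    - 3 * F ^ 2 * Gx ^ 4 / G ^ 4 + Fx * Gx * Fxx / (4 * G) - 3 * F * Fxx * Gx ^ 2 / (2 * G ^ 2)
    + 3 * Fx ^ 2 * Gxx / (4 * G) - 13 * F * Fx * Gx * Gxx / (2 * G ^ 2)
    + 7 * F ^ 2 * Gx ^ 2 * Gxx / G ^ 3 + 2 * F * Fxx * Gxx / G - 2 * F ^ 2 * Gxx ^ 2 / G ^ 2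
    + F * Gx * Fxxx / (2 * G) + 3 * F * Fx * Gxxx / G - 3 * F ^ 2 * Gx * Gxxx / G ^ 2
    + F ^ 2 * Gxxxx / G

/-- The compatibility condition at the resonance `3` says that `Γ` does not depend on `x`. -/
theorem compatThree_eq (hXT : ∀ φ, X (T φ) = T (X φ)) (hfn : f * n = 1) (hyz : T y = X z)
    (hXi : X i = 0) (hTi : T i = 0) (hXh : X half = 0) (hTh : T half = 0) (hhalf : 2 * half = 1)
    (hρ : ρ = n * X f - y) (hτ : τ = n * T f - z)
    (hκ : κ = (half * X f + f * y + i * k₂) * n) (hκb : κb = (half * X f + f * y - i * k₂) * n)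
    (hη : η = (h₁ + i * (half * z - half ^ 2 * (n * T f) + k₂ * (half * y - half ^ 2 * (n * X f))
      + half * X k₂ + Γ)) * n)
    (hηb : ηb = (h₁ - i * (half * z - half ^ 2 * (n * T f) + k₂ * (half * y - half ^ 2 * (n * X f))
      + half * X k₂ + Γ)) * n)
    (ε : R →+* ℂ) :
    ε (compatThree X T 0 (2 * i * n) (κ + κb + 2 * ρ) (κ - κb - 2 * ρ)
      (η - (ηb - i * n * τ + X ρ + ρ ^ 2 + κb * ρ))) = 24 * ε i * ε n * ε (X Γ) := by
  have hXn : X n = -n ^ 2 * X f := X.leibniz_of_mul_eq_one (by rw [mul_comm, hfn])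
  have hTn : T n = -n ^ 2 * T f := T.leibniz_of_mul_eq_one (by rw [mul_comm, hfn])
  have hf0 : ε f ≠ 0 := fun h0 => by
    have := congrArg ε hfn
    simp [h0] at this
  have hεn : ε n = (ε f)⁻¹ := by
    have := congrArg ε hfn
    rw [map_mul, map_one] at this
    exact eq_inv_of_mul_eq_one_right this
  have hεh : ε half = 1 / 2 := by
    have := congrArg ε hhalf
    rw [map_mul, map_one, map_ofNat] at this
    linear_combination this / 2
  subst hρ hτ hκ hκb hη hηb
  simp only [compatThree, map_add, map_sub, map_neg, Derivation.leibniz, Derivation.leibniz_pow,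
    Derivation.map_ofNat, smul_eq_mul, nsmul_eq_mul, mul_zero, add_zero,
    Nat.cast_ofNat, Nat.add_one_sub_one, pow_one, neg_mul, hXn, hTn, hXT, hyz, hXi, hTi, hXh, hTh,
    map_mul, map_pow, map_ofNat, hεn, hεh, sub_zero]
  field_simp
  ring

/-- In terms of the logarithmic derivative `g₁` of `g` the function `potentialJet` is a polynomial
in the derivatives of `g`. -/
theorem potentialJet_log {K : Type*} [Field K] [CharZero K] (γ γ' F Fx Fxx Fxxx Ft Ftt Fxt G
    g₁ g₂ g₃ g₄ k kx kxx kt kxt : K) (hF : F ≠ 0) (hG : G ≠ 0) :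
    potentialJet γ γ' F Fx Fxx Fxxx Ft Ftt Fxt G (G * g₁) (G * g₂) (G * g₃) (G * g₄)
      k kx kxx kt kxt =
    4 * γ ^ 2 + 2 * γ' - 3 * Ft ^ 2 / (4 * F ^ 2) + Ftt / (2 * F)
    - 3 * k * Ft * Fx / (2 * F ^ 2) + kt * Fx / (2 * F) - 3 * k ^ 2 * Fx ^ 2 / (4 * F ^ 2)
    + kx * Ft / F + 3 * k * kx * Fx / (2 * F) - kx ^ 2 + k * Fxt / F - kxt
    + k ^ 2 * Fxx / (2 * F) - k * kxx
    + (- Fx ^ 2 * g₁ ^ 2 / 2 + 7 * F * Fx * g₁ ^ 3 / 2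
    - 3 * F ^ 2 * g₁ ^ 4 + Fx * g₁ * Fxx / 4 - 3 * F * Fxx * g₁ ^ 2 / 2
    + 3 * Fx ^ 2 * g₂ / 4 - 13 * F * Fx * g₁ * g₂ / 2
    + 7 * F ^ 2 * g₁ ^ 2 * g₂ + 2 * F * Fxx * g₂ - 2 * F ^ 2 * g₂ ^ 2
    + F * g₁ * Fxxx / 2 + 3 * F * Fx * g₃ - 3 * F ^ 2 * g₁ * g₃ + F ^ 2 * g₄) := by
  unfold potentialJet
  field_simp
  ring

set_option maxHeartbeats 1600000 in
/-- The compatibility condition at the resonance `4`. -/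
theorem compatFour_eq (hXT : ∀ φ, X (T φ) = T (X φ)) (hfn : f * n = 1) (hyz : T y = X z)
    (hXi : X i = 0) (hTi : T i = 0) (hXh : X half = 0) (hTh : T half = 0) (hhalf : 2 * half = 1)
    (hΓ : X Γ = 0)
    (hρ : ρ = n * X f - y) (hτ : τ = n * T f - z)
    (hκ : κ = (half * X f + f * y + i * k₂) * n) (hκb : κb = (half * X f + f * y - i * k₂) * n)
    (hη : η = (h₁ + i * (half * z - half ^ 2 * (n * T f) + k₂ * (half * y - half ^ 2 * (n * X f))
      + half * X k₂ + Γ)) * n)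
    (hηb : ηb = (h₁ - i * (half * z - half ^ 2 * (n * T f) + k₂ * (half * y - half ^ 2 * (n * X f))
      + half * X k₂ + Γ)) * n)
    (hi : i ^ 2 = -1) (hg0 : ∃ gi, g * gi = 1) (hg : X g = g * y) (ε : R →+* ℂ)
    (h0 : compatFour X T 0 (2 * i * n) (κ + κb + 2 * ρ) (κ - κb - 2 * ρ)
      (η + (ηb - i * n * τ + X ρ + ρ ^ 2 + κb * ρ))
      (η - (ηb - i * n * τ + X ρ + ρ ^ 2 + κb * ρ)) = 0) :
    ε (X f) * ε (X h₁) + 2 * ε f * ε (X (X h₁)) =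
      potentialJet (ε Γ) (ε (T Γ)) (ε f) (ε (X f)) (ε (X (X f))) (ε (X (X (X f)))) (ε (T f))
        (ε (T (T f))) (ε (T (X f))) (ε g) (ε (X g)) (ε (X (X g))) (ε (X (X (X g))))
        (ε (X (X (X (X g))))) (ε k₂) (ε (X k₂)) (ε (X (X k₂))) (ε (T k₂)) (ε (T (X k₂))) := by
  have hXn : X n = -n ^ 2 * X f := X.leibniz_of_mul_eq_one (by rw [mul_comm, hfn])
  have hTn : T n = -n ^ 2 * T f := T.leibniz_of_mul_eq_one (by rw [mul_comm, hfn])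
  have hTXy : T (X y) = X (X z) := by rw [← hXT, hyz]
  have hTΓ : X (T Γ) = 0 := by rw [hXT, hΓ, map_zero]
  have hf0 : ε f ≠ 0 := fun h0 => by
    have := congrArg ε hfn
    simp [h0] at this
  have hG0 : ε g ≠ 0 := fun h0 => by
    obtain ⟨gi, hgi⟩ := hg0
    have := congrArg ε hgi
    simp [h0] at this
  have hεn : ε n = (ε f)⁻¹ := by
    have := congrArg ε hfn
    rw [map_mul, map_one] at this
    exact eq_inv_of_mul_eq_one_right this
  have hεh : ε half = 1 / 2 := by
    have := congrArg ε hhalf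
    rw [map_mul, map_one, map_ofNat] at this
    linear_combination this / 2
  have hεi : ε i ^ 2 = -1 := by rw [← map_pow, hi, map_neg, map_one]
  -- The ring data involve `g` only through `y = gₓ/g` and `z = gₜ/g`, so the derivatives of `g` on
  -- the right are expressed by those of `y`.
  have hg2 : X (X g) = g * (X y + y ^ 2) := by
    simp only [hg, Derivation.leibniz, smul_eq_mul]
    ring
  have hg3 : X (X (X g)) = g * (X (X y) + 3 * y * X y + y ^ 3) := by
    rw [hg2]
    simp only [hg, Derivation.leibniz, Derivation.leibniz_pow, map_add, smul_eq_mul,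
      nsmul_eq_mul, Nat.cast_ofNat, Nat.add_one_sub_one, pow_one]
    ring
  have hg4 : X (X (X (X g))) = g * (X (X (X y)) + 4 * y * X (X y) + 3 * X y ^ 2
      + 6 * y ^ 2 * X y + y ^ 4) := by
    rw [hg3]
    simp only [hg, Derivation.leibniz, Derivation.leibniz_pow, map_add, smul_eq_mul,
      nsmul_eq_mul, Nat.cast_ofNat, Nat.add_one_sub_one, Derivation.map_ofNat]
    ring
  rw [hg4, hg3, hg2, hg, map_mul ε g, map_mul ε g, map_mul ε g, map_mul ε g,
    potentialJet_log _ _ _ _ _ _ _ _ _ _ _ _ _ _ _ _ _ _ _ hf0 hG0]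
  replace h0 := congrArg ε h0
  subst hρ hτ hκ hκb hη hηb
  simp only [compatFour, map_add, map_sub, map_neg, Derivation.leibniz, Derivation.leibniz_pow,
    Derivation.map_ofNat, smul_eq_mul, nsmul_eq_mul, mul_zero, add_zero,
    Nat.cast_ofNat, Nat.add_one_sub_one, pow_one, neg_mul, hXn, hTn, hXT, hyz, hXi, hTi, hXh, hTh,
    hTXy, map_mul, map_pow, map_ofNat, hεn, hεh, map_zero, sub_zero, hΓ] at h0 ⊢
  -- The factor `f² / 108` normalises the coefficient of `h₁ₓₓ` to `2 f`. The multiple of `i² + 1`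
  -- accounts for the terms of the right-hand side that arise with the factor `i²`; those depending
  -- on `f` and `g` through `x`-derivatives alone need no such correction.
  linear_combination (norm := skip) (ε f ^ 2 / 108) * h0 -
    (4 * ε Γ ^ 2 + 2 * ε (T Γ) - 3 * ε (T f) ^ 2 / (4 * ε f ^ 2) + ε (T (T f)) / (2 * ε f)
      - 3 * ε k₂ * ε (T f) * ε (X f) / (2 * ε f ^ 2) + ε (T k₂) * ε (X f) / (2 * ε f)
      - 3 * ε k₂ ^ 2 * ε (X f) ^ 2 / (4 * ε f ^ 2) + ε (X k₂) * ε (T f) / ε f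
      + 3 * ε k₂ * ε (X k₂) * ε (X f) / (2 * ε f) - ε (X k₂) ^ 2 + ε k₂ * ε (T (X f)) / ε f
      - ε (T (X k₂)) + ε k₂ ^ 2 * ε (X (X f)) / (2 * ε f) - ε k₂ * ε (X (X k₂))) * hεi
  field_simp
  ring

end Resonance

/-! ### The test families `x + c t` and `exp x + c t` -/

section Stages

open TopologicalSpace SmoothRing

variable {I J : Opens ℝ} {f g h k : ℝ → ℝ → ℂ}

/-- The coefficients of the equation and their complex conjugates as elements of the algebra of
smooth functions. -/
structure Coefficients (I J : Opens ℝ) (f g h k : ℝ → ℝ → ℂ) where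
  (F Fb G Gb H Hb K Kb Fi Fbi Gi : SmoothRing ℂ I J)
  rep_F : Rep f F
  rep_Fb : Rep (cconj f) Fb
  rep_G : Rep g G
  rep_Gb : Rep (cconj g) Gb
  rep_H : Rep h H
  rep_Hb : Rep (cconj h) Hb
  rep_K : Rep k K
  rep_Kb : Rep (cconj k) Kb
  mul_Fi : F * Fi = 1
  mul_Fbi : Fb * Fbi = 1
  mul_Gi : G * Gi = 1

theorem SmoothOn.cconj (hf : SmoothOn I J f) : SmoothOn I J (cconj f) :=
  Complex.conjCLE.contDiff.comp_contDiffOn hf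

theorem Coefficients.nonempty (hf : SmoothOn I J f) (hg : SmoothOn I J g) (hh : SmoothOn I J h)
    (hk : SmoothOn I J k) (hf0 : ∀ x ∈ I, ∀ t ∈ J, f x t ≠ 0)
    (hg0 : ∀ x ∈ I, ∀ t ∈ J, g x t ≠ 0) : Nonempty (Coefficients I J f g h k) := by
  obtain ⟨Fi, hFi⟩ := exists_mul_eq_one hf.toRing fun p => hf0 _ p.2.1 _ p.2.2
  obtain ⟨Fbi, hFbi⟩ := exists_mul_eq_one hf.cconj.toRing fun p =>
    (map_ne_zero (starRingEnd ℂ)).2 (hf0 _ p.2.1 _ p.2.2)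
  obtain ⟨Gi, hGi⟩ := exists_mul_eq_one hg.toRing fun p => hg0 _ p.2.1 _ p.2.2
  exact ⟨⟨_, _, _, _, _, _, _, _, _, _, _, rep_toRing hf, rep_toRing hf.cconj, rep_toRing hg,
    rep_toRing hg.cconj, rep_toRing hh, rep_toRing hh.cconj, rep_toRing hk, rep_toRing hk.cconj,
    hFi, hFbi, hGi⟩⟩

theorem SmoothRing.rep_intCast (c : ℤ) : Rep (fun _ _ => ((c : ℝ) : ℂ)) (c : SmoothRing ℂ I J) :=
  ⟨contDiffOn_const, fun p => by simp⟩

namespace Coefficients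

variable (C : Coefficients I J f g h k)

variable (I J) in
/-- The imaginary unit. -/
def i : SmoothRing ℂ I J := algebraMap ℂ _ Complex.I

/-- The logarithmic derivative of `f / g` in `x`. -/
def ρ : SmoothRing ℂ I J := C.Fi * X ℂ I J C.F - C.Gi * X ℂ I J C.G

/-- The logarithmic derivative of `f / g` in `t`. -/
def τ : SmoothRing ℂ I J := C.Fi * T ℂ I J C.F - C.Gi * T ℂ I J C.G

/-- For `Φ = x + c t` one has `p = 1` and `q = c`, so `Y = X` and `c` enters polynomially. -/
theorem compat_affine (hI : (I : Set ℝ).Nonempty) (hJ : (J : Set ℝ).Nonempty)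
    (H : PassesPainleveTest I J f g h k) (c : ℤ) :
    C.Fb * C.G = C.F * C.Gb ∧
    compatThree (X ℂ I J) (T ℂ I J - (c : SmoothRing ℂ I J) • X ℂ I J)
      (i I J * C.Fi + -i I J * C.Fbi) (i I J * C.Fi - -i I J * C.Fbi)
      (C.K * C.Fi + C.Kb * C.Fbi + 2 * C.ρ + c * (i I J * C.Fi + -i I J * C.Fbi))
      (C.K * C.Fi - C.Kb * C.Fbi - 2 * C.ρ + c * (i I J * C.Fi - -i I J * C.Fbi))
      (C.H * C.Fi - (C.Hb * C.Fbi + -i I J * C.Fbi * C.τ + X ℂ I J C.ρ + C.ρ ^ 2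
        + C.Kb * C.Fbi * C.ρ)) = 0 ∧
    compatFour (X ℂ I J) (T ℂ I J - (c : SmoothRing ℂ I J) • X ℂ I J)
      (i I J * C.Fi + -i I J * C.Fbi) (i I J * C.Fi - -i I J * C.Fbi)
      (C.K * C.Fi + C.Kb * C.Fbi + 2 * C.ρ + c * (i I J * C.Fi + -i I J * C.Fbi))
      (C.K * C.Fi - C.Kb * C.Fbi - 2 * C.ρ + c * (i I J * C.Fi - -i I J * C.Fbi))
      (C.H * C.Fi + (C.Hb * C.Fbi + -i I J * C.Fbi * C.τ + X ℂ I J C.ρ + C.ρ ^ 2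
        + C.Kb * C.Fbi * C.ρ))
      (C.H * C.Fi - (C.Hb * C.Fbi + -i I J * C.Fbi * C.τ + X ℂ I J C.ρ + C.ρ ^ 2
        + C.Kb * C.Fbi * C.ρ)) = 0 := by
  have hdx : dx (fun x t : ℝ => x + (c : ℝ) * t) = fun _ _ => 1 := by
    funext x t
    simp [dx]
  have hdt : dt (fun x t : ℝ => x + (c : ℝ) * t) = fun _ _ => (c : ℝ) := by
    funext x t
    simp [dt]
  have hΦ : RealAnalyticOn I J (fun x t : ℝ => x + (c : ℝ) * t) := fun p _ =>
    analyticAt_fst.add (analyticAt_const.mul analyticAt_snd)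
  have h := compat_of_passesPainleveTest C.rep_F C.rep_Fb C.rep_G C.rep_Gb C.rep_H C.rep_Hb
    C.rep_K C.rep_Kb C.mul_Fi C.mul_Fbi C.mul_Gi hI hJ H hΦ (fun x _ t _ => by simp [hdx])
    (i := i I J) (p := 1) (q := (c : SmoothRing ℂ I J)) (P := 1) (π := 0) (Y := X ℂ I J) (ν := C.ρ)
    (a := i I J * C.Fi) (b := -i I J * C.Fbi) (κ := C.K * C.Fi) (κb := C.Kb * C.Fbi)
    (by rw [hdx]; exact_mod_cast rep_one) (by rw [hdt]; exact rep_intCast c) (mul_one 1)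
    (T ℂ I J).map_one_eq_zero rfl (one_smul _ _).symm (by rw [one_pow, mul_one])
    (by rw [one_pow, mul_one]) (by rw [(X ℂ I J).map_one_eq_zero, mul_zero]) (mul_one _).symm
    (mul_one _).symm rfl rfl (by rw [mul_zero, zero_add, one_mul]; rfl)
  simp only [one_pow, mul_one, mul_zero, zero_add] at h
  exact h

/-- A second family with nonconstant `Φₓ = exp x`: it supplies a relation independent of the affine
one at points where `fₓ = 0`. `S` and `D` may stay unspecified because they drop out of the
differences in `c`. -/
theorem compat_exp (hI : (I : Set ℝ).Nonempty) (hJ : (J : Set ℝ).Nonempty)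
    (H : PassesPainleveTest I J f g h k) {p P : SmoothRing ℂ I J}
    (hp : Rep (fun x _ => (Real.exp x : ℂ)) p) (hpP : p * P = 1) (hpX : X ℂ I J p = p)
    (hpT : T ℂ I J p = 0) :
    ∃ S D, ∀ c : ℤ,
    compatThree (P • X ℂ I J) (T ℂ I J - (c : SmoothRing ℂ I J) • (P • X ℂ I J))
      (i I J * C.Fi * P ^ 2 + -i I J * C.Fbi * P ^ 2)
      (i I J * C.Fi * P ^ 2 - -i I J * C.Fbi * P ^ 2)
      (2 * P + C.K * C.Fi * P + C.Kb * C.Fbi * P + 2 * (2 * P + P * C.ρ)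
        + c * (i I J * C.Fi * P ^ 2 + -i I J * C.Fbi * P ^ 2))
      (C.K * C.Fi * P - C.Kb * C.Fbi * P - 2 * (2 * P + P * C.ρ)
        + c * (i I J * C.Fi * P ^ 2 - -i I J * C.Fbi * P ^ 2)) D = 0 ∧
    compatFour (P • X ℂ I J) (T ℂ I J - (c : SmoothRing ℂ I J) • (P • X ℂ I J))
      (i I J * C.Fi * P ^ 2 + -i I J * C.Fbi * P ^ 2)
      (i I J * C.Fi * P ^ 2 - -i I J * C.Fbi * P ^ 2)
      (2 * P + C.K * C.Fi * P + C.Kb * C.Fbi * P + 2 * (2 * P + P * C.ρ)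
        + c * (i I J * C.Fi * P ^ 2 + -i I J * C.Fbi * P ^ 2))
      (C.K * C.Fi * P - C.Kb * C.Fbi * P - 2 * (2 * P + P * C.ρ)
        + c * (i I J * C.Fi * P ^ 2 - -i I J * C.Fbi * P ^ 2)) S D = 0 := by
  refine ⟨C.H * C.Fi * P ^ 2 + (C.Hb * C.Fbi * P ^ 2 + -i I J * C.Fbi * P ^ 2 * C.τ
      + (P • X ℂ I J) (2 * P + P * C.ρ) + (2 * P + P * C.ρ) ^ 2
      + (P + C.Kb * C.Fbi * P) * (2 * P + P * C.ρ)),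
    C.H * C.Fi * P ^ 2 - (C.Hb * C.Fbi * P ^ 2 + -i I J * C.Fbi * P ^ 2 * C.τ
      + (P • X ℂ I J) (2 * P + P * C.ρ) + (2 * P + P * C.ρ) ^ 2
      + (P + C.Kb * C.Fbi * P) * (2 * P + P * C.ρ)), fun c => ?_⟩
  have hdx : dx (fun x t : ℝ => Real.exp x + (c : ℝ) * t) = fun x _ => Real.exp x := by
    funext x t
    simp [dx]
  have hdt : dt (fun x t : ℝ => Real.exp x + (c : ℝ) * t) = fun _ _ => (c : ℝ) := by
    funext x t
    simp [dt]
  have hΦ : RealAnalyticOn I J (fun x t : ℝ => Real.exp x + (c : ℝ) * t) := fun p _ =>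
    analyticAt_fst.rexp.add (analyticAt_const.mul analyticAt_snd)
  exact (compat_of_passesPainleveTest C.rep_F C.rep_Fb C.rep_G C.rep_Gb C.rep_H C.rep_Hb
    C.rep_K C.rep_Kb C.mul_Fi C.mul_Fbi C.mul_Gi hI hJ H hΦ
    (fun x _ t _ => by rw [hdx]; exact (Real.exp_pos x).ne')
    (p := p) (q := (c : SmoothRing ℂ I J)) (P := P) (π := P)
    (by rw [hdx]; exact hp) (by rw [hdt]; exact rep_intCast c) hpP
    hpT rfl rfl rfl rfl (by
      rw [Derivation.smul_apply, hpX, smul_eq_mul, mul_comm P p, hpP, mul_one])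
    rfl rfl rfl rfl rfl).2

end Coefficients

end Stages

/-- If `s ≠ 0`, the first relation gives `d = 0` and the second becomes `-48 s⁴ = 0`. -/
theorem eq_zero_of_resonances {K : Type*} [Field K] [CharZero K] {s d : K}
    (h : 12 * (d * s ^ 2) = 0) (h' : 24 * (-9 * d * s ^ 3 + 9 * d ^ 2 * s ^ 2 - 2 * s ^ 4) = 0) :
    s = 0 := by
  by_contra hs
  obtain rfl : d = 0 := by simpa [hs] using h
  simp [hs] at h'

/-! ### Algebraic consequences for the drift -/

section Conclusions

variable {𝕜 R : Type*} [CommRing 𝕜] [CommRing R] [Algebra 𝕜 R] {X T : Derivation 𝕜 R R}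

theorem drift_of_resonance {i f n g gi K Kb : R} (hXi : X i = 0) (h2 : IsUnit (2 : R))
    (hi : IsUnit i) (hfn : f * n = 1)
    (h : 2 * i * n * (K * n + Kb * n + 2 * (n * X f - gi * X g)) + 3 * X (2 * i * n) = 0) :
    K + Kb = X f + 2 * f * (gi * X g) := by
  have hXn : X n = -n ^ 2 * X f := X.leibniz_of_mul_eq_one (by rw [mul_comm, hfn])
  have hn : IsUnit n := IsUnit.of_mul_eq_one f (by rw [mul_comm, hfn])
  simp only [Derivation.leibniz, Derivation.map_ofNat, hXi, hXn, smul_eq_mul] at h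
  refine ((h2.mul hi).mul (hn.pow 2)).mul_left_cancel ?_
  linear_combination h - 4 * i * n * gi * X g * hfn

theorem sub_intCast_zero_smul (X T : Derivation 𝕜 R R) : T - ((0 : ℤ) : R) • X = T :=
  Derivation.ext fun φ => by simp

/-- Here `P = exp (-x)`. Differentiating the weight `P²` produces the shift `-2 d`, while in the
other factor the terms `6 d` and `-6 d` cancel, so that factor is the affine one; what remains is a
common `P⁶`. -/
theorem deriv_exp_weight {P d k : R} (hP : X P = -P) (hPu : IsUnit P)
    (h : 36 * ((P • X) (d * P ^ 2) * (d * P ^ 2 * (P * (k + 6)) + 3 * (P • X) (d * P ^ 2))) = 0) :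
    36 * ((X d - 2 * d) * (d * k + 3 * X d)) = 0 := by
  simp only [Derivation.smul_apply, Derivation.leibniz, Derivation.leibniz_pow, hP, smul_eq_mul,
    nsmul_eq_mul, Nat.cast_ofNat, Nat.add_one_sub_one, pow_one] at h
  refine (hPu.pow 6).mul_left_cancel ?_
  linear_combination h

end Conclusions

/-! ### Reality, drift and potential from the resonances -/

section Stages

open TopologicalSpace SmoothRing

variable {I J : Opens ℝ} {f g h k : ℝ → ℝ → ℂ}

namespace Coefficients

variable (C : Coefficients I J f g h k)

theorem ev_i (p : ↥((I : Set ℝ) ×ˢ (J : Set ℝ))) : ev p (i I J) = Complex.I := (ev p).commutes _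

theorem isUnit_i : IsUnit (i I J) := by
  obtain ⟨ψ, hψ⟩ := exists_mul_eq_one (i I J) fun p => by
    rw [ev_i]
    exact Complex.I_ne_zero
  exact IsUnit.of_mul_eq_one ψ hψ

/-- Here `s = i (1/f - 1/f̄)`. The finite differences make it vanish at each point, evaluation there
being what allows division. -/
theorem Fi_eq (hI : (I : Set ℝ).Nonempty) (hJ : (J : Set ℝ).Nonempty)
    (H : PassesPainleveTest I J f g h k) : C.Fbi = C.Fi := by
  have h3 := mul_sq_eq_zero_of_compatThree fun c => (C.compat_affine hI hJ H c).2.1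
  have h4 := mul_cube_eq_zero_of_compatFour fun c => (C.compat_affine hI hJ H c).2.2
  refine ext_ev fun p => ?_
  replace h3 := congrArg (ev p) h3
  replace h4 := congrArg (ev p) h4
  generalize i I J * C.Fi - -i I J * C.Fbi = d at h3 h4
  have hs : ev p (i I J * C.Fi + -i I J * C.Fbi) = 0 := by
    generalize i I J * C.Fi + -i I J * C.Fbi = s at h3 h4
    simp only [map_mul, map_add, map_sub, map_neg, map_pow, map_zero, map_ofNat] at h3 h4
    exact eq_zero_of_resonances h3 h4
  simp only [map_mul, map_add, map_neg, ev_i] at hs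
  exact mul_left_cancel₀ Complex.I_ne_zero (by linear_combination -hs)

theorem F_eq (hI : (I : Set ℝ).Nonempty) (hJ : (J : Set ℝ).Nonempty)
    (H : PassesPainleveTest I J f g h k) : C.Fb = C.F := by
  have h1 := C.mul_Fbi
  rw [C.Fi_eq hI hJ H] at h1
  linear_combination C.F * h1 - C.Fb * C.mul_Fi

/-- The two leading orders give `f̄ g = f ḡ`, and `f` is already real. -/
theorem G_eq (hI : (I : Set ℝ).Nonempty) (hJ : (J : Set ℝ).Nonempty)
    (H : PassesPainleveTest I J f g h k) : C.Gb = C.G := by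
  have h1 := (C.compat_affine hI hJ H 0).1
  rw [C.F_eq hI hJ H] at h1
  exact ((IsUnit.of_mul_eq_one _ C.mul_Fi).mul_left_cancel h1).symm

theorem compat_zero (hI : (I : Set ℝ).Nonempty) (hJ : (J : Set ℝ).Nonempty)
    (H : PassesPainleveTest I J f g h k) (c : ℤ) :
    compatThree (X ℂ I J) (T ℂ I J - (c : SmoothRing ℂ I J) • X ℂ I J) 0 (2 * i I J * C.Fi)
      (C.K * C.Fi + C.Kb * C.Fi + 2 * C.ρ)
      (C.K * C.Fi - C.Kb * C.Fi - 2 * C.ρ + c * (2 * i I J * C.Fi))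
      (C.H * C.Fi - (C.Hb * C.Fi - i I J * C.Fi * C.τ + X ℂ I J C.ρ + C.ρ ^ 2
        + C.Kb * C.Fi * C.ρ)) = 0 ∧
    compatFour (X ℂ I J) (T ℂ I J - (c : SmoothRing ℂ I J) • X ℂ I J) 0 (2 * i I J * C.Fi)
      (C.K * C.Fi + C.Kb * C.Fi + 2 * C.ρ)
      (C.K * C.Fi - C.Kb * C.Fi - 2 * C.ρ + c * (2 * i I J * C.Fi))
      (C.H * C.Fi + (C.Hb * C.Fi - i I J * C.Fi * C.τ + X ℂ I J C.ρ + C.ρ ^ 2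
        + C.Kb * C.Fi * C.ρ))
      (C.H * C.Fi - (C.Hb * C.Fi - i I J * C.Fi * C.τ + X ℂ I J C.ρ + C.ρ ^ 2
        + C.Kb * C.Fi * C.ρ)) = 0 := by
  have h := (C.compat_affine hI hJ H c).2
  have e1 : i I J * C.Fi + -i I J * C.Fi = 0 := by ring
  have e2 : i I J * C.Fi - -i I J * C.Fi = 2 * i I J * C.Fi := by ring
  have e3 : C.Hb * C.Fi + -i I J * C.Fi * C.τ = C.Hb * C.Fi - i I J * C.Fi * C.τ := by ring
  rw [C.Fi_eq hI hJ H, e1, e2, e3, mul_zero, add_zero] at h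
  exact h

/-- The affine and the exponential family give `Xd · Q = 0` and `(Xd - 2d) · Q = 0` with the same `Q
= d k + 3 Xd`. Subtracting leaves `2 d Q = 0`, and `d = 2i/f` has no zeros. -/
theorem drift (hI : (I : Set ℝ).Nonempty) (hJ : (J : Set ℝ).Nonempty)
    (H : PassesPainleveTest I J f g h k) :
    C.K + C.Kb = X ℂ I J C.F + 2 * C.F * (C.Gi * X ℂ I J C.G) := by
  obtain ⟨p, hp⟩ : ∃ p : SmoothRing ℂ I J, Rep (fun x _ => (Real.exp x : ℂ)) p :=
    ⟨_, rep_toRing (ContDiff.contDiffOn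
      (Complex.ofRealCLM.contDiff.comp (Real.contDiff_exp.comp contDiff_fst)))⟩
  have hpX : X ℂ I J p = p := Rep.eq (F := fun x _ => (Real.exp x : ℂ)) (by
    have : dx (fun x _ : ℝ => (Real.exp x : ℂ)) = fun x _ => (Real.exp x : ℂ) := by
      funext x t
      exact (Real.hasDerivAt_exp x).ofReal_comp.deriv
    exact this ▸ hp.dx) hp
  have hpT : T ℂ I J p = 0 := hp.dt.eq_zero fun x _ t _ => by simp [dt]
  obtain ⟨P, hP⟩ := exists_mul_eq_one p fun q => by
    rw [hp.2]
    exact Complex.ofReal_ne_zero.2 (Real.exp_pos _).ne'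
  have hXP : X ℂ I J P = -P := by
    rw [(X ℂ I J).leibniz_of_mul_eq_one (by rw [mul_comm, hP] : P * p = 1), hpX, smul_eq_mul]
    linear_combination -P * hP
  have h1 := deriv_mul_eq_zero_of_compat (fun c => (C.compat_zero hI hJ H c).1)
    fun c => (C.compat_zero hI hJ H c).2
  obtain ⟨S, D, hSD⟩ := C.compat_exp hI hJ H hp hP hpX hpT
  have e1 : i I J * C.Fi * P ^ 2 + -i I J * C.Fi * P ^ 2 = 0 := by ring
  have e2 : i I J * C.Fi * P ^ 2 - -i I J * C.Fi * P ^ 2 = 2 * i I J * C.Fi * P ^ 2 := by ring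
  have e3 : 2 * P + C.K * C.Fi * P + C.Kb * C.Fi * P + 2 * (2 * P + P * C.ρ) =
      P * (C.K * C.Fi + C.Kb * C.Fi + 2 * C.ρ + 6) := by ring
  rw [C.Fi_eq hI hJ H, e1, e2, e3] at hSD
  simp only [mul_zero, add_zero] at hSD
  have h2 := deriv_exp_weight hXP (IsUnit.of_mul_eq_one p (by rw [mul_comm, hP]))
    (deriv_mul_eq_zero_of_compat (fun c => (hSD c).1) fun c => (hSD c).2)
  have hi : X ℂ I J (i I J) = 0 := (X ℂ I J).map_algebraMap _
  refine drift_of_resonance hi isUnit_two isUnit_i C.mul_Fi (ext_ev fun q => ?_)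
  have hd : ev q (2 * i I J * C.Fi) ≠ 0 := by
    have := congrArg (ev q) C.mul_Fi
    rw [map_mul, map_one] at this
    rw [map_mul, map_mul, map_ofNat, ev_i]
    exact mul_ne_zero (mul_ne_zero two_ne_zero Complex.I_ne_zero) (right_ne_zero_of_mul_eq_one this)
  replace h1 := congrArg (ev q) h1
  replace h2 := congrArg (ev q) h2
  rw [ρ] at h1 h2
  generalize C.K * C.Fi + C.Kb * C.Fi + 2 * (C.Fi * X ℂ I J C.F - C.Gi * X ℂ I J C.G) = K' at *
  generalize 2 * i I J * C.Fi = d at *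
  simp only [map_mul, map_add, map_sub, map_zero, map_ofNat] at h1 h2 ⊢
  refine mul_left_cancel₀ hd ?_
  linear_combination h1 / 72 - h2 / 72

/-- The imaginary part of `k`, provided that `Kb` is conjugate to `K`. -/
def k₂ : SmoothRing ℂ I J := algebraMap ℂ _ (-(Complex.I / 2)) * (C.K - C.Kb)

/-- The real part of `h`. -/
def h₁ : SmoothRing ℂ I J := algebraMap ℂ _ (1 / 2) * (C.H + C.Hb)

/-- The imaginary part of `h`. -/
def h₂ : SmoothRing ℂ I J := algebraMap ℂ _ (-(Complex.I / 2)) * (C.H - C.Hb)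

variable (I J) in
/-- The constant `1 / 2`. -/
def half : SmoothRing ℂ I J := algebraMap ℂ _ (1 / 2)

/-- The difference of the imaginary part of `h` and its value for `γ = 0`. -/
def Γ : SmoothRing ℂ I J :=
  C.h₂ - (half I J * (C.Gi * T ℂ I J C.G) - half I J ^ 2 * (C.Fi * T ℂ I J C.F)
    + C.k₂ * (half I J * (C.Gi * X ℂ I J C.G) - half I J ^ 2 * (C.Fi * X ℂ I J C.F))
    + half I J * X ℂ I J C.k₂)

theorem ev_half (p : ↥((I : Set ℝ) ×ˢ (J : Set ℝ))) : ev p (half I J) = 1 / 2 :=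
  (ev p).commutes _

theorem two_mul_half : 2 * half I J = 1 := ext_ev fun p => by
  rw [map_mul, ev_half, map_ofNat, map_one]
  norm_num

theorem H_eq : C.H = C.h₁ + i I J * C.h₂ := ext_ev fun p => by
  have e1 : ∀ c : ℂ, ev p (algebraMap ℂ (SmoothRing ℂ I J) c) = c := (ev p).commutes
  rw [h₁, h₂, map_add, map_mul, map_mul, map_mul, map_add, map_sub, ev_i, e1, e1]
  linear_combination (ev p C.H - ev p C.Hb) / 2 * Complex.I_sq

theorem Hb_eq : C.Hb = C.h₁ - i I J * C.h₂ := ext_ev fun p => by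
  have e1 : ∀ c : ℂ, ev p (algebraMap ℂ (SmoothRing ℂ I J) c) = c := (ev p).commutes
  rw [h₁, h₂, map_sub, map_mul, map_mul, map_mul, map_add, map_sub, ev_i, e1, e1]
  linear_combination -(ev p C.H - ev p C.Hb) / 2 * Complex.I_sq

theorem i_mul_k₂ : i I J * C.k₂ = half I J * (C.K - C.Kb) := ext_ev fun p => by
  have e1 : ∀ c : ℂ, ev p (algebraMap ℂ (SmoothRing ℂ I J) c) = c := (ev p).commutes
  rw [k₂, map_mul, map_mul, map_mul, map_sub, ev_i, e1, ev_half]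
  linear_combination -(ev p C.K - ev p C.Kb) / 2 * Complex.I_sq

theorem h₂_eq : C.h₂ = half I J * (C.Gi * T ℂ I J C.G) - half I J ^ 2 * (C.Fi * T ℂ I J C.F)
    + C.k₂ * (half I J * (C.Gi * X ℂ I J C.G) - half I J ^ 2 * (C.Fi * X ℂ I J C.F))
    + half I J * X ℂ I J C.k₂ + C.Γ := by
  rw [Γ]
  ring

theorem T_logDeriv : T ℂ I J (C.Gi * X ℂ I J C.G) = X ℂ I J (C.Gi * T ℂ I J C.G) := by
  have hX : X ℂ I J C.Gi = -C.Gi ^ 2 * X ℂ I J C.G :=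
    (X ℂ I J).leibniz_of_mul_eq_one (by rw [mul_comm, C.mul_Gi])
  have hT : T ℂ I J C.Gi = -C.Gi ^ 2 * T ℂ I J C.G :=
    (T ℂ I J).leibniz_of_mul_eq_one (by rw [mul_comm, C.mul_Gi])
  simp only [Derivation.leibniz, hX, hT, smul_eq_mul, X_T]
  ring

theorem half_drift (hI : (I : Set ℝ).Nonempty) (hJ : (J : Set ℝ).Nonempty)
    (H : PassesPainleveTest I J f g h k) :
    C.K = half I J * X ℂ I J C.F + C.F * (C.Gi * X ℂ I J C.G) + i I J * C.k₂ ∧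
    C.Kb = half I J * X ℂ I J C.F + C.F * (C.Gi * X ℂ I J C.G) - i I J * C.k₂ := by
  have h1 := C.drift hI hJ H
  have h2 := two_mul_half (I := I) (J := J)
  rw [i_mul_k₂]
  constructor
  · linear_combination half I J * h1 - (C.K - C.F * (C.Gi * X ℂ I J C.G)) * h2
  · linear_combination half I J * h1 - (C.Kb - C.F * (C.Gi * X ℂ I J C.G)) * h2

/-- The order 3 condition for `Φ = x` equals `24 i f⁻¹ X Γ`, and the factor in front has no zeros.
-/
theorem X_Γ (hI : (I : Set ℝ).Nonempty) (hJ : (J : Set ℝ).Nonempty)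
    (H : PassesPainleveTest I J f g h k) : X ℂ I J C.Γ = 0 := ext_ev fun p => by
  have h0 := (C.compat_zero hI hJ H 0).1
  rw [sub_intCast_zero_smul, Int.cast_zero, zero_mul, add_zero] at h0
  have hk := C.half_drift hI hJ H
  have h1 := compatThree_eq X_T C.mul_Fi C.T_logDeriv ((X ℂ I J).map_algebraMap _)
    ((T ℂ I J).map_algebraMap _) ((X ℂ I J).map_algebraMap _) ((T ℂ I J).map_algebraMap _)
    two_mul_half (i := i I J) (h₁ := C.h₁) (k₂ := C.k₂) (Γ := C.Γ) (ρ := C.ρ) (τ := C.τ) rfl rfl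
    (congrArg (· * C.Fi) hk.1) (congrArg (· * C.Fi) hk.2)
    (congrArg (· * C.Fi) (C.h₂_eq ▸ C.H_eq)) (congrArg (· * C.Fi) (C.h₂_eq ▸ C.Hb_eq))
    ((ev p : SmoothRing ℂ I J →ₐ[ℂ] ℂ) : SmoothRing ℂ I J →+* ℂ)
  rw [h0, map_zero] at h1
  have hF : ev p C.Fi ≠ 0 := by
    have := congrArg (ev p) C.mul_Fi
    rw [map_mul, map_one] at this
    exact right_ne_zero_of_mul_eq_one this
  have h2 : 24 * Complex.I * ev p C.Fi * ev p (X ℂ I J C.Γ) = 0 := by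
    rw [← ev_i p]
    exact h1.symm
  rw [map_zero]
  exact (mul_eq_zero.1 h2).resolve_left
    (mul_ne_zero (mul_ne_zero (by norm_num) Complex.I_ne_zero) hF)

theorem potential (hI : (I : Set ℝ).Nonempty) (hJ : (J : Set ℝ).Nonempty)
    (H : PassesPainleveTest I J f g h k) (ε : SmoothRing ℂ I J →+* ℂ) :
    ε (X ℂ I J C.F) * ε (X ℂ I J C.h₁) + 2 * ε C.F * ε (X ℂ I J (X ℂ I J C.h₁)) =
      potentialJet (ε C.Γ) (ε (T ℂ I J C.Γ)) (ε C.F) (ε (X ℂ I J C.F))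
        (ε (X ℂ I J (X ℂ I J C.F))) (ε (X ℂ I J (X ℂ I J (X ℂ I J C.F)))) (ε (T ℂ I J C.F))
        (ε (T ℂ I J (T ℂ I J C.F))) (ε (T ℂ I J (X ℂ I J C.F))) (ε C.G) (ε (X ℂ I J C.G))
        (ε (X ℂ I J (X ℂ I J C.G))) (ε (X ℂ I J (X ℂ I J (X ℂ I J C.G))))
        (ε (X ℂ I J (X ℂ I J (X ℂ I J (X ℂ I J C.G))))) (ε C.k₂) (ε (X ℂ I J C.k₂))
        (ε (X ℂ I J (X ℂ I J C.k₂))) (ε (T ℂ I J C.k₂)) (ε (T ℂ I J (X ℂ I J C.k₂))) := by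
  have h0 := (C.compat_zero hI hJ H 0).2
  rw [sub_intCast_zero_smul, Int.cast_zero, zero_mul, add_zero] at h0
  have hk := C.half_drift hI hJ H
  refine compatFour_eq X_T C.mul_Fi C.T_logDeriv ((X ℂ I J).map_algebraMap _)
    ((T ℂ I J).map_algebraMap _) ((X ℂ I J).map_algebraMap _) ((T ℂ I J).map_algebraMap _)
    two_mul_half (C.X_Γ hI hJ H) (i := i I J) (h₁ := C.h₁) (k₂ := C.k₂) (Γ := C.Γ) (ρ := C.ρ)
    (τ := C.τ) rfl rfl
    (congrArg (· * C.Fi) hk.1) (congrArg (· * C.Fi) hk.2)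
    (congrArg (· * C.Fi) (C.h₂_eq ▸ C.H_eq)) (congrArg (· * C.Fi) (C.h₂_eq ▸ C.Hb_eq))
    (ext_ev fun p => ?_) ⟨_, C.mul_Gi⟩ ?_ ε h0
  · rw [map_pow, ev_i, Complex.I_sq, map_neg, map_one]
  · rw [← mul_assoc, C.mul_Gi, one_mul]

end Coefficients

end Stages

/-! ### The correction terms of the explicit potential -/

section SpatialIdentity

variable {𝕜 R K : Type*} [CommRing 𝕜] [CommRing R] [Algebra 𝕜 R] [Field K] [CharZero K]
  {X T : Derivation 𝕜 R R}

/-- `P` is the explicit term built from `f` and `g`, and `D` the integrand of the drift term.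
Inserting a function with `x`-derivative `X P + D` in the left side of the equation reproduces all
of the right side but twice the bracket of `F_ε`. -/
theorem potentialJet_eq_of_corrections {f n g gi k half P D : R} (hXT : ∀ φ, X (T φ) = T (X φ))
    (hfn : f * n = 1) (hg : g * gi = 1) (hXh : X half = 0) (hhalf : 2 * half = 1)
    (hP : P = half ^ 2 * (X f * X g * gi) - half ^ 2 * (f * X g ^ 2 * gi ^ 2)
      + half * (f * X (X g) * gi))
    (hD : D = half * n * (k * T f * n - T k + k ^ 2 * X f * (half * n) - k * X k))
    (ε : R →+* K) (γ γ' : K) :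
    ε (X f) * (ε (X P) + ε D) + 2 * ε f * (ε (X (X P)) + ε (X D)) =
      potentialJet γ γ' (ε f) (ε (X f)) (ε (X (X f))) (ε (X (X (X f)))) (ε (T f))
        (ε (T (T f))) (ε (T (X f))) (ε g) (ε (X g)) (ε (X (X g))) (ε (X (X (X g))))
        (ε (X (X (X (X g))))) (ε k) (ε (X k)) (ε (X (X k))) (ε (T k)) (ε (T (X k)))
      - 2 * (2 * γ ^ 2 + γ' - 3 * ε (T f) ^ 2 / (8 * ε f ^ 2) + ε (T (T f)) / (4 * ε f)) := by
  have hXn : X n = -n ^ 2 * X f := X.leibniz_of_mul_eq_one (by rw [mul_comm, hfn])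
  have hXg : X gi = -gi ^ 2 * X g := X.leibniz_of_mul_eq_one (by rw [mul_comm, hg])
  have hf0 : ε f ≠ 0 := fun h0 => by
    have := congrArg ε hfn
    simp [h0] at this
  have hg0 : ε g ≠ 0 := fun h0 => by
    have := congrArg ε hg
    simp [h0] at this
  have hεn : ε n = (ε f)⁻¹ := by
    have := congrArg ε hfn
    rw [map_mul, map_one] at this
    exact eq_inv_of_mul_eq_one_right this
  have hεg : ε gi = (ε g)⁻¹ := by
    have := congrArg ε hg
    rw [map_mul, map_one] at this
    exact eq_inv_of_mul_eq_one_right this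
  have hεh : ε half = 1 / 2 := by
    have := congrArg ε hhalf
    rw [map_mul, map_one, map_ofNat] at this
    linear_combination this / 2
  subst hP hD
  simp only [potentialJet, map_add, map_sub, map_neg, Derivation.leibniz, Derivation.leibniz_pow,
    smul_eq_mul, nsmul_eq_mul, mul_zero, add_zero, Nat.cast_ofNat,
    Nat.add_one_sub_one, pow_one, neg_mul, hXn, hXg, hXT, hXh, map_mul, map_pow, map_ofNat, hεn,
    hεg, hεh, Derivation.map_ofNat]
  field_simp
  ring

end SpatialIdentity

/-! ### Primitives on an interval -/

section Integral

variable {I : Set ℝ} {u : ℝ → ℝ} {x₀ x : ℝ}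

theorem hasDerivAt_integral_of_continuousOn (hI : IsOpen I) (hI' : I.OrdConnected)
    (hu : ContinuousOn u I) (hx₀ : x₀ ∈ I) (hx : x ∈ I) :
    HasDerivAt (fun x => ∫ y in x₀..x, u y) (u x) x :=
  intervalIntegral.integral_hasDerivAt_right
    ((hu.mono (hI'.uIcc_subset hx₀ hx)).intervalIntegrable)
    (hu.stronglyMeasurableAtFilter hI x hx) (hu.continuousAt (hI.mem_nhds hx))

theorem eq_of_hasDerivAt_zero (hI : IsOpen I) (hI' : I.OrdConnected)
    (hu : ∀ x ∈ I, HasDerivAt u 0 x) (hx₀ : x₀ ∈ I) (hx : x ∈ I) : u x = u x₀ :=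
  hI.is_const_of_deriv_eq_zero hI'.isPreconnected
    (fun y hy => (hu y hy).differentiableAt.differentiableWithinAt) (fun y hy => (hu y hy).deriv)
    hx hx₀

end Integral

/-! ### General solution of the equation for `h₁` -/

section RealPotential

open TopologicalSpace SmoothRing

variable {I J : Opens ℝ} {f g k : ℝ → ℝ → ℝ} {x t : ℝ}

theorem SmoothRing.rep_of_ev {𝕜 : Type*} [NormedField 𝕜] [NormedAlgebra ℝ 𝕜] {F : ℝ → ℝ → 𝕜}
    {φ : SmoothRing 𝕜 I J} (h : ∀ p, F p.1.1 p.1.2 = ev p φ) : Rep F φ :=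
  (rep_extendZero φ).congr fun _ hx _ ht =>
    (h ⟨_, hx, ht⟩).trans ((rep_extendZero φ).apply hx ht).symm

theorem SmoothOn.continuousOn_x {E : Type*} [NormedAddCommGroup E] [NormedSpace ℝ E]
    {F : ℝ → ℝ → E} (hF : SmoothOn I J F) (ht : t ∈ J) : ContinuousOn (fun y => F y t) I :=
  fun _ hx => (hF.hasDerivAt_dx hx ht).continuousAt.continuousWithinAt

theorem SmoothOn.contDiffOn_t {E : Type*} [NormedAddCommGroup E] [NormedSpace ℝ E]
    {F : ℝ → ℝ → E} (hF : SmoothOn I J F) (hx : x ∈ I) : ContDiffOn ℝ ∞ (F x) J :=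
  ContDiffOn.comp (g := Function.uncurry F) (f := fun s : ℝ => (x, s)) hF
    (contDiff_const.prodMk contDiff_id).contDiffOn fun _ hs => ⟨hx, hs⟩

/-- The terms of the explicit potential that depend on the derivatives of `g`. -/
def gradientTerm (f g : ℝ → ℝ → ℝ) (x t : ℝ) : ℝ :=
  dx f x t * dx g x t / (4 * g x t) - f x t * dx g x t ^ 2 / (4 * g x t ^ 2)
    + f x t * dx (dx g) x t / (2 * g x t)

theorem corrections (hf : SmoothOn I J f) (hg : SmoothOn I J g) (hk : SmoothOn I J k)
    (hf0 : ∀ x ∈ I, ∀ t ∈ J, f x t ≠ 0) (hg0 : ∀ x ∈ I, ∀ t ∈ J, g x t ≠ 0) :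
    SmoothOn I J (gradientTerm f g) ∧ SmoothOn I J (driftTerm f k) ∧
    ∀ γ : ℝ → ℝ, ∀ x ∈ I, ∀ t ∈ J,
      dx f x t * (dx (gradientTerm f g) x t + driftTerm f k x t)
        + 2 * f x t * (dx (dx (gradientTerm f g)) x t + dx (driftTerm f k) x t) =
      potentialRHS f g k γ x t - 2 * (2 * γ t ^ 2 + deriv γ t - 3 * dt f x t ^ 2 / (8 * f x t ^ 2)
        + dt (dt f) x t / (4 * f x t)) := by
  have hF := rep_toRing hf
  have hG := rep_toRing hg
  have hK := rep_toRing hk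
  generalize hf.toRing = F at hF
  generalize hg.toRing = G at hG
  generalize hk.toRing = K at hK
  obtain ⟨n, hn⟩ := exists_mul_eq_one F fun p => (hF.2 p).symm ▸ hf0 _ p.2.1 _ p.2.2
  obtain ⟨gi, hgi⟩ := exists_mul_eq_one G fun p => (hG.2 p).symm ▸ hg0 _ p.2.1 _ p.2.2
  have en : ∀ p, ev p n = (f p.1.1 p.1.2)⁻¹ := fun p => by
    rw [← hF.2 p]
    refine eq_inv_of_mul_eq_one_right ?_
    rw [← map_mul, hn, map_one]
  have eg : ∀ p, ev p gi = (g p.1.1 p.1.2)⁻¹ := fun p => by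
    rw [← hG.2 p]
    refine eq_inv_of_mul_eq_one_right ?_
    rw [← map_mul, hgi, map_one]
  obtain ⟨half, hhalf⟩ : ∃ c, c = algebraMap ℝ (SmoothRing ℝ I J) (1 / 2) := ⟨_, rfl⟩
  have eh : ∀ p, ev p half = 1 / 2 := fun p => hhalf ▸ (ev p).commutes (1 / 2 : ℝ)
  have h2 : 2 * half = 1 := ext_ev fun p => by
    rw [map_mul, eh, map_ofNat, map_one]
    norm_num
  obtain ⟨P, hP⟩ : ∃ P, P = half ^ 2 * (X ℝ I J F * X ℝ I J G * gi)
      - half ^ 2 * (F * X ℝ I J G ^ 2 * gi ^ 2) + half * (F * X ℝ I J (X ℝ I J G) * gi) := ⟨_, rfl⟩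
  obtain ⟨D, hD⟩ : ∃ D, D = half * n * (K * T ℝ I J F * n - T ℝ I J K
      + K ^ 2 * X ℝ I J F * (half * n) - K * X ℝ I J K) := ⟨_, rfl⟩
  have rP : Rep (gradientTerm f g) P := rep_of_ev fun p => by
    rw [hP, gradientTerm]
    simp only [map_add, map_sub, map_mul, map_pow, eh, eg, hF.2, hF.dx.2, hG.dx.2, hG.dx.dx.2]
    have := hg0 _ p.2.1 _ p.2.2
    field_simp
    ring
  have rD : Rep (driftTerm f k) D := rep_of_ev fun p => by
    rw [hD, driftTerm]
    simp only [map_add, map_sub, map_mul, map_pow, eh, en, hF.dt.2, hF.dx.2, hK.2, hK.dx.2,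
      hK.dt.2]
    have := hf0 _ p.2.1 _ p.2.2
    field_simp
  refine ⟨rP.1, rD.1, fun γ x hx t ht => ?_⟩
  have := potentialJet_eq_of_corrections X_T hn hgi (hhalf ▸ (X ℝ I J).map_algebraMap _) h2 hP hD
    ((ev ⟨(x, t), hx, ht⟩ : SmoothRing ℝ I J →ₐ[ℝ] ℝ) : SmoothRing ℝ I J →+* ℝ) (γ t) (deriv γ t)
  simp only [RingHom.coe_coe] at this
  simp only [hF.2, hG.2, hK.2, hF.dx.2, hF.dx.dx.2, hF.dx.dx.dx.2, hF.dt.2, hF.dt.dt.2,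
    hF.dx.dt.2, hG.dx.2, hG.dx.dx.2, hG.dx.dx.dx.2, hG.dx.dx.dx.dx.2, hK.dx.2, hK.dx.dx.2,
    hK.dt.2, hK.dx.dt.2, rP.dx.2, rP.dx.dx.2, rD.2, rD.dx.2] at this
  exact this

theorem hasDerivAt_sqrt_abs (hf : SmoothOn I J f) (hf0 : ∀ x ∈ I, ∀ t ∈ J, f x t ≠ 0)
    (hx : x ∈ I) (ht : t ∈ J) :
    HasDerivAt (fun y => √|f y t|) (dx f x t * √|f x t| / (2 * f x t)) x := by
  have h0 := hf0 x hx t ht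
  have h : HasDerivAt (fun y => |f y t|) ((SignType.sign (f x t) : ℝ) * dx f x t) x :=
    HasDerivAt.comp (h₂ := fun z => |z|) x (hasDerivAt_abs h0) (hf.hasDerivAt_dx hx ht)
  refine (h.sqrt (abs_ne_zero.2 h0)).congr_deriv ?_
  have h1 : √|f x t| ^ 2 = |f x t| := Real.sq_sqrt (abs_nonneg _)
  have h2 : √|f x t| ≠ 0 := (Real.sqrt_pos.2 (abs_pos.2 h0)).ne'
  have h3 : (SignType.sign (f x t) : ℝ) * f x t = |f x t| := sign_mul_self _
  rw [div_eq_div_iff (mul_ne_zero two_ne_zero h2) (mul_ne_zero two_ne_zero h0)]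
  linear_combination 2 * dx f x t * h3 - 2 * dx f x t * h1

theorem hasDerivAt_one_div_sqrt_abs (hf : SmoothOn I J f) (hf0 : ∀ x ∈ I, ∀ t ∈ J, f x t ≠ 0)
    (hx : x ∈ I) (ht : t ∈ J) :
    HasDerivAt (fun y => 1 / √|f y t|) (-(dx f x t / (2 * f x t)) * (1 / √|f x t|)) x := by
  have h0 := hf0 x hx t ht
  have h2 : √|f x t| ≠ 0 := (Real.sqrt_pos.2 (abs_pos.2 h0)).ne'
  simp only [one_div]
  refine ((hasDerivAt_sqrt_abs hf hf0 hx ht).inv h2).congr_deriv ?_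
  field_simp

theorem continuousOn_Feps (hf : SmoothOn I J f) (hf0 : ∀ x ∈ I, ∀ t ∈ J, f x t ≠ 0) (γ : ℝ → ℝ)
    (ht : t ∈ J) : ContinuousOn (fun y => Feps f γ y t) I := by
  have hsign : ∀ y ∈ I, Real.sign (f y t) = f y t / |f y t| := fun y hy => by
    rcases (hf0 y hy t ht).lt_or_gt with h | h
    · rw [Real.sign_of_neg h, abs_of_neg h, div_neg, div_self h.ne]
    · rw [Real.sign_of_pos h, abs_of_pos h, div_self h.ne']
  have hc := hf.continuousOn_x ht
  have h1 : ContinuousOn (fun y => f y t / |f y t| / √|f y t| *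
      (2 * γ t ^ 2 + deriv γ t - 3 * dt f y t ^ 2 / (8 * f y t ^ 2)
        + dt (dt f) y t / (4 * f y t))) I := by
    have h2 := hf.dt.continuousOn_x ht
    have h3 := hf.dt.dt.continuousOn_x ht
    have h0 : ∀ y ∈ I, f y t ≠ 0 := fun y hy => hf0 y hy t ht
    refine ((hc.div hc.abs fun y hy => abs_ne_zero.2 (h0 y hy)).div hc.abs.sqrt fun y hy =>
      (Real.sqrt_pos.2 (abs_pos.2 (h0 y hy))).ne').mul ?_
    exact (continuousOn_const.sub ((continuousOn_const.mul (h2.pow 2)).div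
      (continuousOn_const.mul (hc.pow 2)) fun y hy =>
        mul_ne_zero (by norm_num) (pow_ne_zero 2 (h0 y hy)))).add
      (h3.div (continuousOn_const.mul hc) fun y hy => mul_ne_zero (by norm_num) (h0 y hy))
  exact h1.congr fun y hy => by simp only [Feps, hsign y hy]

/-- The two square roots combine to `|f|`, which the sign of `f` turns into `f`; the result is the
bracket in `F_ε`. -/
theorem mul_Feps (hf0 : f x t ≠ 0) (γ : ℝ → ℝ) :
    f x t * (1 / √|f x t| * Feps f γ x t) =
      2 * γ t ^ 2 + deriv γ t - 3 * dt f x t ^ 2 / (8 * f x t ^ 2) + dt (dt f) x t / (4 * f x t) := by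
  have h1 : √|f x t| ^ 2 = |f x t| := Real.sq_sqrt (abs_nonneg _)
  have h2 : √|f x t| ≠ 0 := (Real.sqrt_pos.2 (abs_pos.2 hf0)).ne'
  have h3 : f x t * Real.sign (f x t) = |f x t| := by
    rcases hf0.lt_or_gt with h | h
    · rw [Real.sign_of_neg h, abs_of_neg h, mul_neg_one]
    · rw [Real.sign_of_pos h, abs_of_pos h, mul_one]
  have h4 : f x t * (1 / √|f x t| * (Real.sign (f x t) / √|f x t|)) = 1 := by
    rw [div_mul_div_comm, ← sq, h1, one_mul, mul_div_assoc', h3, div_self (abs_ne_zero.2 hf0)]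
  rw [Feps, ← mul_assoc (1 / _), ← mul_assoc, h4, one_mul]

/-- The derivative in `x` of the explicit potential. -/
def rePotentialDx (f g k : ℝ → ℝ → ℝ) (γ A : ℝ → ℝ) (x₀ x t : ℝ) : ℝ :=
  1 / √|f x t| * ((∫ z in x₀..x, Feps f γ z t) + A t)
    + dx (gradientTerm f g) x t + driftTerm f k x t

theorem hasDerivAt_rePotential (hI' : (I : Set ℝ).OrdConnected) (hf : SmoothOn I J f)
    (hg : SmoothOn I J g) (hk : SmoothOn I J k) (hf0 : ∀ x ∈ I, ∀ t ∈ J, f x t ≠ 0)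
    (hg0 : ∀ x ∈ I, ∀ t ∈ J, g x t ≠ 0) (γ A B : ℝ → ℝ) {x₀ : ℝ} (hx₀ : x₀ ∈ I) (hx : x ∈ I)
    (ht : t ∈ J) :
    HasDerivAt (fun y => rePotential f g k γ A B x₀ y t) (rePotentialDx f g k γ A x₀ x t) x := by
  obtain ⟨hP, hD, -⟩ := corrections hf hg hk hf0 hg0
  have hF := continuousOn_Feps hf hf0 γ ht
  have hs : ContinuousOn (fun y => 1 / √|f y t|) I := fun y hy =>
    (hasDerivAt_one_div_sqrt_abs hf hf0 hy ht).continuousAt.continuousWithinAt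
  have hQ : ContinuousOn (fun y => ∫ z in x₀..y, Feps f γ z t) I := fun y hy =>
    (hasDerivAt_integral_of_continuousOn I.isOpen hI' hF hx₀ hy).continuousAt.continuousWithinAt
  have h1 := hasDerivAt_integral_of_continuousOn (u := fun y => 1 / √|f y t| *
    ∫ z in x₀..y, Feps f γ z t) I.isOpen hI' (hs.mul hQ) hx₀ hx
  have h2 := hasDerivAt_integral_of_continuousOn I.isOpen hI' (hD.continuousOn_x ht) hx₀ hx
  have h3 := hasDerivAt_integral_of_continuousOn I.isOpen hI' hs hx₀ hx
  have h := ((((h1.add (hP.hasDerivAt_dx hx ht)).add h2).add (h3.const_mul (A t))).add_const (B t))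
  refine (h.congr_deriv ?_).congr_of_eventuallyEq (Filter.Eventually.of_forall fun y => ?_)
  · simp only [rePotentialDx]
    ring
  · simp only [rePotential, gradientTerm, Pi.add_apply]
    ring

/-- Variation of constants: differentiating the factor `1/√|f|` cancels the term in `fₓ`,
differentiating the integral of `F_ε` gives the bracket, and the corrections give the rest. -/
theorem exists_hasDerivAt_rePotentialDx (hI' : (I : Set ℝ).OrdConnected) (hf : SmoothOn I J f)
    (hg : SmoothOn I J g) (hk : SmoothOn I J k) (hf0 : ∀ x ∈ I, ∀ t ∈ J, f x t ≠ 0)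
    (hg0 : ∀ x ∈ I, ∀ t ∈ J, g x t ≠ 0) (γ A : ℝ → ℝ) {x₀ : ℝ} (hx₀ : x₀ ∈ I) (hx : x ∈ I)
    (ht : t ∈ J) :
    ∃ d, HasDerivAt (fun y => rePotentialDx f g k γ A x₀ y t) d x ∧
      dx f x t * rePotentialDx f g k γ A x₀ x t + 2 * f x t * d = potentialRHS f g k γ x t := by
  obtain ⟨hP, hD, hcorr⟩ := corrections hf hg hk hf0 hg0
  have h1 := hasDerivAt_integral_of_continuousOn I.isOpen hI' (continuousOn_Feps hf hf0 γ ht) hx₀ hx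
  refine ⟨_, (((hasDerivAt_one_div_sqrt_abs hf hf0 hx ht).mul (h1.add_const (A t))).add
    (hP.dx.hasDerivAt_dx hx ht)).add (hD.hasDerivAt_dx hx ht), ?_⟩
  have e1 := hcorr γ x hx t ht
  have e2 := mul_Feps (hf0 x hx t ht) γ
  have e3 : 2 * f x t * (dx f x t / (2 * f x t)) = dx f x t :=
    mul_div_cancel₀ _ (mul_ne_zero two_ne_zero (hf0 x hx t ht))
  rw [rePotentialDx]
  linear_combination e1 + 2 * e2 - (1 / √|f x t| * ((∫ z in x₀..x, Feps f γ z t) + A t)) * e3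

theorem potentialEquation_rePotential (hI' : (I : Set ℝ).OrdConnected) (hf : SmoothOn I J f)
    (hg : SmoothOn I J g) (hk : SmoothOn I J k) (hf0 : ∀ x ∈ I, ∀ t ∈ J, f x t ≠ 0)
    (hg0 : ∀ x ∈ I, ∀ t ∈ J, g x t ≠ 0) (γ A B : ℝ → ℝ) {x₀ : ℝ} (hx₀ : x₀ ∈ I) :
    PotentialEquation I J f g k γ (rePotential f g k γ A B x₀) := by
  intro x hx t ht
  obtain ⟨d, hd, he⟩ :=
    exists_hasDerivAt_rePotentialDx hI' hf hg hk hf0 hg0 γ A hx₀ hx ht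
  have h1 : ∀ y ∈ I, dx (rePotential f g k γ A B x₀) y t = rePotentialDx f g k γ A x₀ y t :=
    fun y hy => (hasDerivAt_rePotential hI' hf hg hk hf0 hg0 γ A B hx₀ hy ht).deriv
  have h2 : dx (dx (rePotential f g k γ A B x₀)) x t = d :=
    (hd.congr_of_eventuallyEq ((I.isOpen.mem_nhds hx |> Filter.mem_of_superset) h1)).deriv
  rw [h1 x hx, h2, he]

theorem exists_eq_rePotential (hI' : (I : Set ℝ).OrdConnected) (hf : SmoothOn I J f)
    (hg : SmoothOn I J g) (hk : SmoothOn I J k) (hf0 : ∀ x ∈ I, ∀ t ∈ J, f x t ≠ 0)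
    (hg0 : ∀ x ∈ I, ∀ t ∈ J, g x t ≠ 0) (γ : ℝ → ℝ) {x₀ : ℝ} (hx₀ : x₀ ∈ I) {h₁ : ℝ → ℝ → ℝ}
    (hh : SmoothOn I J h₁) (heq : PotentialEquation I J f g k γ h₁) :
    ∃ A B : ℝ → ℝ, ContDiffOn ℝ ∞ A J ∧ ContDiffOn ℝ ∞ B J ∧
      ∀ x ∈ I, ∀ t ∈ J, h₁ x t = rePotential f g k γ A B x₀ x t := by
  obtain ⟨hP, hD, -⟩ := corrections hf hg hk hf0 hg0
  have hR : ∀ x ∈ I, ∀ t ∈ J, √|f x t| ≠ 0 := fun x hx t ht =>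
    (Real.sqrt_pos.2 (abs_pos.2 (hf0 x hx t ht))).ne'
  -- At `x = x₀` all integrals vanish, so (3) and its `x`-derivative there determine `B` and `A`.
  -- The absolute value keeps `A` smooth because `f` has no zeros.
  refine ⟨fun t => √|f x₀ t| * (dx h₁ x₀ t - dx (gradientTerm f g) x₀ t - driftTerm f k x₀ t),
    fun t => h₁ x₀ t - gradientTerm f g x₀ t, ?_, ?_, fun x hx t ht => ?_⟩
  · refine ContDiffOn.mul (ContDiffOn.sqrt (fun t ht => ?_) fun t ht => ?_)
      (((hh.dx.contDiffOn_t hx₀).sub (hP.dx.contDiffOn_t hx₀)).sub (hD.contDiffOn_t hx₀))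
    · exact (((hf.contDiffOn_t hx₀).contDiffAt (J.isOpen.mem_nhds ht)).abs
        (hf0 x₀ hx₀ t ht)).contDiffWithinAt
    · exact abs_ne_zero.2 (hf0 x₀ hx₀ t ht)
  · exact (hh.contDiffOn_t hx₀).sub (hP.contDiffOn_t hx₀)
  generalize hA : (fun t => √|f x₀ t| * (dx h₁ x₀ t - dx (gradientTerm f g) x₀ t
    - driftTerm f k x₀ t)) = A
  generalize hB : (fun t => h₁ x₀ t - gradientTerm f g x₀ t) = B
  -- The difference of two solutions has an `x`-derivative solving the homogeneous equation, so its
  -- product with `√|f|` is constant in `x`; the choice of `A` makes this constant zero.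
  have hv : ∀ y ∈ I, (dx h₁ y t - rePotentialDx f g k γ A x₀ y t) * √|f y t| =
      (dx h₁ x₀ t - rePotentialDx f g k γ A x₀ x₀ t) * √|f x₀ t| := fun y hy =>
    eq_of_hasDerivAt_zero (u := fun y => (dx h₁ y t - rePotentialDx f g k γ A x₀ y t) * √|f y t|)
      I.isOpen hI' (fun y hy => by
        obtain ⟨d, hd, he⟩ :=
          exists_hasDerivAt_rePotentialDx hI' hf hg hk hf0 hg0 γ A hx₀ hy ht
        refine (((hh.dx.hasDerivAt_dx hy ht).sub hd).mul
          (hasDerivAt_sqrt_abs hf hf0 hy ht)).congr_deriv ?_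
        have h0 := hf0 y hy t ht
        have e := heq y hy t ht
        simp only [Pi.sub_apply]
        field_simp
        linear_combination (√|f y t|) * (e - he)) hx₀ hy
  have hv0 : dx h₁ x₀ t - rePotentialDx f g k γ A x₀ x₀ t = 0 := by
    have := hR x₀ hx₀ t ht
    rw [rePotentialDx, intervalIntegral.integral_same, ← hA]
    field_simp
    ring
  have hw : ∀ y ∈ I, dx h₁ y t - rePotentialDx f g k γ A x₀ y t = 0 := fun y hy => by
    have := hv y hy
    rw [hv0, zero_mul] at this
    exact (mul_eq_zero.1 this).resolve_right (hR y hy t ht)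
  have h1 := eq_of_hasDerivAt_zero (u := fun y => h₁ y t - rePotential f g k γ A B x₀ y t)
    I.isOpen hI' (fun y hy => ((hh.hasDerivAt_dx hy ht).sub
      (hasDerivAt_rePotential hI' hf hg hk hf0 hg0 γ A B hx₀ hy ht)).congr_deriv (hw y hy)) hx₀ hx
  have h2 : h₁ x₀ t - rePotential f g k γ A B x₀ x₀ t = 0 := by
    simp only [rePotential, intervalIntegral.integral_same, ← hB, gradientTerm]
    ring
  exact sub_eq_zero.1 (h1.trans h2)

end RealPotential

/-! ### Real functions inside the complex algebra -/

section RealFunctions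

open TopologicalSpace SmoothRing

variable {I J : Opens ℝ} {F : ℝ → ℝ → ℝ} {φ : SmoothRing ℂ I J} {x t : ℝ}

/-- The real smooth function `F` restricts to the element `φ` of the algebra of complex smooth
functions on `I × J`. -/
structure SmoothRing.RepReal (F : ℝ → ℝ → ℝ) (φ : SmoothRing ℂ I J) : Prop where
  smooth : SmoothOn I J F
  ev_eq : ∀ p, ev p φ = (F p.1.1 p.1.2 : ℂ)

theorem SmoothRing.RepReal.of_ev (h : ∀ p, ev p φ = (F p.1.1 p.1.2 : ℂ)) : RepReal F φ :=
  ⟨SmoothOn.congr (F := fun x t => (extendZero φ.1 x t).re)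
    (Complex.reCLM.contDiff.comp_contDiffOn φ.2) fun x hx t ht => by
      rw [(rep_extendZero φ).apply hx ht, h]
      exact (Complex.ofReal_re _).symm, h⟩

theorem SmoothRing.RepReal.rep (h : RepReal F φ) : Rep (fun x t => (F x t : ℂ)) φ :=
  ⟨Complex.ofRealCLM.contDiff.comp_contDiffOn h.smooth, h.ev_eq⟩

theorem SmoothRing.RepReal.dx (h : RepReal F φ) : RepReal (VCNLS.dx F) (X ℂ I J φ) :=
  ⟨h.smooth.dx, fun p => (h.rep.dx.2 p).trans
    (h.smooth.hasDerivAt_dx p.2.1 p.2.2).ofReal_comp.deriv⟩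

theorem SmoothRing.RepReal.dt (h : RepReal F φ) : RepReal (VCNLS.dt F) (T ℂ I J φ) :=
  ⟨h.smooth.dt, fun p => (h.rep.dt.2 p).trans
    (h.smooth.hasDerivAt_dt p.2.1 p.2.2).ofReal_comp.deriv⟩

theorem SmoothOn.rePart {f : ℝ → ℝ → ℂ} (hf : SmoothOn I J f) : SmoothOn I J (rePart f) :=
  Complex.reCLM.contDiff.comp_contDiffOn hf

theorem SmoothOn.imPart {f : ℝ → ℝ → ℂ} (hf : SmoothOn I J f) : SmoothOn I J (imPart f) :=
  Complex.imCLM.contDiff.comp_contDiffOn hf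

theorem potentialJet_ofReal (γ γ' F Fx Fxx Fxxx Ft Ftt Fxt G Gx Gxx Gxxx Gxxxx
    k kx kxx kt kxt : ℝ) :
    ((potentialJet γ γ' F Fx Fxx Fxxx Ft Ftt Fxt G Gx Gxx Gxxx Gxxxx k kx kxx kt kxt : ℝ) : ℂ) =
      potentialJet (γ : ℂ) γ' F Fx Fxx Fxxx Ft Ftt Fxt G Gx Gxx Gxxx Gxxxx k kx kxx kt kxt := by
  simp only [potentialJet]
  push_cast
  rfl

theorem deriv_log_sq_div {u v : ℝ → ℝ} {u' v' y : ℝ} (hu : HasDerivAt u u' y)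
    (hv : HasDerivAt v v' y) (hu0 : u y ≠ 0) (hv0 : v y ≠ 0) :
    deriv (fun y => Real.log (v y ^ 2 / u y)) y = 2 * v' / v y - u' / u y := by
  refine (((hv.pow 2).div hu hu0).log (div_ne_zero (pow_ne_zero 2 hv0) hu0)).deriv.trans ?_
  simp only [Pi.pow_apply, Pi.div_apply]
  field_simp
  ring

end RealFunctions

/-! ### The necessary conditions for functions -/

section Necessity

open TopologicalSpace SmoothRing

variable {I J : Opens ℝ} {f g h k : ℝ → ℝ → ℂ}

theorem necessary_conditions (hI' : (I : Set ℝ).OrdConnected)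
    (hf : SmoothOn I J f) (hg : SmoothOn I J g) (hh : SmoothOn I J h) (hk : SmoothOn I J k)
    (hf0 : ∀ x ∈ I, ∀ t ∈ J, f x t ≠ 0) (hg0 : ∀ x ∈ I, ∀ t ∈ J, g x t ≠ 0)
    (hI : (I : Set ℝ).Nonempty) (hJ : (J : Set ℝ).Nonempty) (H : PassesPainleveTest I J f g h k) :
    (∀ x ∈ I, ∀ t ∈ J, (f x t).im = 0 ∧ (g x t).im = 0) ∧
    (∀ x ∈ I, ∀ t ∈ J, (k x t).re =
      1 / 2 * dx (rePart f) x t + (f x t).re * (dx (rePart g) x t / (g x t).re)) ∧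
    ∃ γ : ℝ → ℝ, ContDiffOn ℝ ∞ γ J ∧
      (∀ x ∈ I, ∀ t ∈ J, (h x t).im = imPotential (rePart f) (rePart g) (imPart k) γ x t) ∧
      PotentialEquation I J (rePart f) (rePart g) (imPart k) γ (rePart h) := by
  obtain ⟨C⟩ := Coefficients.nonempty hf hg hh hk hf0 hg0
  have hfim : ∀ x ∈ I, ∀ t ∈ J, (f x t).im = 0 := fun x hx t ht => by
    have e : f x t = cconj f x t := by
      rw [C.rep_F.apply hx ht, ← C.F_eq hI hJ H, ← C.rep_Fb.apply hx ht]
    exact Complex.conj_eq_iff_im.1 e.symm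
  have hgim : ∀ x ∈ I, ∀ t ∈ J, (g x t).im = 0 := fun x hx t ht => by
    have e : g x t = cconj g x t := by
      rw [C.rep_G.apply hx ht, ← C.G_eq hI hJ H, ← C.rep_Gb.apply hx ht]
    exact Complex.conj_eq_iff_im.1 e.symm
  have rF : RepReal (rePart f) C.F := .of_ev fun p => by
    rw [C.rep_F.2]
    exact Complex.ext rfl (hfim _ p.2.1 _ p.2.2)
  have rG : RepReal (rePart g) C.G := .of_ev fun p => by
    rw [C.rep_G.2]
    exact Complex.ext rfl (hgim _ p.2.1 _ p.2.2)
  have e1 : ∀ p, ∀ c : ℂ, ev p (algebraMap ℂ (SmoothRing ℂ I J) c) = c := fun p => (ev p).commutes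
  have rK : RepReal (imPart k) C.k₂ := .of_ev fun p => by
    rw [Coefficients.k₂, map_mul, e1, map_sub, C.rep_K.2, C.rep_Kb.2, cconj, Complex.sub_conj,
      imPart]
    push_cast
    linear_combination -((k p.1.1 p.1.2).im : ℂ) * Complex.I_sq
  have rH : RepReal (rePart h) C.h₁ := .of_ev fun p => by
    rw [Coefficients.h₁, map_mul, e1, map_add, C.rep_H.2, C.rep_Hb.2, cconj, Complex.add_conj,
      rePart]
    push_cast
    ring
  have rH2 : RepReal (imPart h) C.h₂ := .of_ev fun p => by
    rw [Coefficients.h₂, map_mul, e1, map_sub, C.rep_H.2, C.rep_Hb.2, cconj, Complex.sub_conj,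
      imPart]
    push_cast
    linear_combination -((h p.1.1 p.1.2).im : ℂ) * Complex.I_sq
  have hF0 : ∀ x ∈ I, ∀ t ∈ J, rePart f x t ≠ 0 := fun x hx t ht h0 =>
    hf0 x hx t ht (Complex.ext h0 (hfim x hx t ht))
  have hG0 : ∀ x ∈ I, ∀ t ∈ J, rePart g x t ≠ 0 := fun x hx t ht h0 =>
    hg0 x hx t ht (Complex.ext h0 (hgim x hx t ht))
  have eFi : ∀ p, ev p C.Fi = ((rePart f p.1.1 p.1.2 : ℝ) : ℂ)⁻¹ := fun p => by
    rw [← rF.ev_eq p]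
    refine eq_inv_of_mul_eq_one_right ?_
    rw [← map_mul, C.mul_Fi, map_one]
  have eGi : ∀ p, ev p C.Gi = ((rePart g p.1.1 p.1.2 : ℝ) : ℂ)⁻¹ := fun p => by
    rw [← rG.ev_eq p]
    refine eq_inv_of_mul_eq_one_right ?_
    rw [← map_mul, C.mul_Gi, map_one]
  -- A real-valued representative of `C.Γ`, with the logarithmic derivatives written out. It is
  -- constant in `x` on the interval `I`, so `Γ x₀` serves as `γ` and its derivative is `dt Γ` at
  -- every `x`.
  obtain ⟨Γ, hΓ⟩ : ∃ Γ : ℝ → ℝ → ℝ, Γ = fun x t => imPart h x t -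
    (1 / 2 * ((rePart g x t)⁻¹ * dt (rePart g) x t)
      - (1 / 2) ^ 2 * ((rePart f x t)⁻¹ * dt (rePart f) x t)
      + imPart k x t * (1 / 2 * ((rePart g x t)⁻¹ * dx (rePart g) x t)
      - (1 / 2) ^ 2 * ((rePart f x t)⁻¹ * dx (rePart f) x t))
      + 1 / 2 * dx (imPart k) x t) := ⟨_, rfl⟩
  have rΓ : RepReal Γ C.Γ := .of_ev fun p => by
    rw [Coefficients.Γ]
    simp only [map_sub, map_add, map_mul, map_pow, Coefficients.ev_half, rH2.ev_eq, eFi, eGi,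
      rG.dt.ev_eq, rF.dt.ev_eq, rK.ev_eq, rG.dx.ev_eq, rF.dx.ev_eq, rK.dx.ev_eq, hΓ]
    push_cast
    rfl
  obtain ⟨x₀, hx₀⟩ := hI
  have hΓx : ∀ x ∈ I, ∀ t ∈ J, Γ x t = Γ x₀ t := fun x hx t ht =>
    eq_of_hasDerivAt_zero (u := fun y => Γ y t) I.isOpen hI' (fun y hy => by
      have := rΓ.dx.ev_eq ⟨(y, t), hy, ht⟩
      rw [C.X_Γ ⟨x₀, hx₀⟩ hJ H, map_zero] at this
      exact (Complex.ofReal_eq_zero.1 this.symm) ▸ rΓ.smooth.hasDerivAt_dx hy ht) hx₀ hx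
  have hΓt : ∀ x ∈ I, ∀ t ∈ J, dt Γ x t = deriv (Γ x₀) t := fun x hx t ht =>
    Filter.EventuallyEq.deriv_eq <|
      (J.isOpen.mem_nhds ht |> Filter.mem_of_superset) fun s hs => hΓx x hx s hs
  refine ⟨fun x hx t ht => ⟨hfim x hx t ht, hgim x hx t ht⟩, fun x hx t ht => ?_, Γ x₀,
    rΓ.smooth.contDiffOn_t hx₀, fun x hx t ht => ?_, fun x hx t ht => ?_⟩
  · have h1 := congrArg (ev ⟨(x, t), hx, ht⟩) (C.half_drift ⟨x₀, hx₀⟩ hJ H).1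
    simp only [map_add, map_mul, Coefficients.ev_half, Coefficients.ev_i, rF.ev_eq, rF.dx.ev_eq,
      rG.dx.ev_eq, eGi, rK.ev_eq, C.rep_K.2] at h1
    have h2 : k x t = ((1 / 2 * dx (rePart f) x t + rePart f x t * (dx (rePart g) x t /
        rePart g x t) : ℝ) : ℂ) + (imPart k x t : ℂ) * Complex.I := by
      rw [h1]
      push_cast
      ring
    have h3 := congrArg Complex.re h2
    rwa [Complex.add_re, Complex.re_ofReal_mul, Complex.I_re, mul_zero, add_zero,
      Complex.ofReal_re] at h3
  · have h1 : dt (fun x t => Real.log (rePart g x t ^ 2 / rePart f x t)) x t = _ :=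
      deriv_log_sq_div (rF.smooth.hasDerivAt_dt hx ht) (rG.smooth.hasDerivAt_dt hx ht)
        (hF0 x hx t ht) (hG0 x hx t ht)
    have h2 : dx (fun x t => Real.log (rePart g x t ^ 2 / rePart f x t)) x t = _ :=
      deriv_log_sq_div (rF.smooth.hasDerivAt_dx hx ht) (rG.smooth.hasDerivAt_dx hx ht)
        (hF0 x hx t ht) (hG0 x hx t ht)
    rw [imPotential, h1, h2, ← hΓx x hx t ht, hΓ]
    simp only [imPart]
    ring
  · have h1 := C.potential ⟨x₀, hx₀⟩ hJ H
      ((ev ⟨(x, t), hx, ht⟩ : SmoothRing ℂ I J →ₐ[ℂ] ℂ) : SmoothRing ℂ I J →+* ℂ)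
    simp only [RingHom.coe_coe] at h1
    simp only [rF.ev_eq, rF.dx.ev_eq, rF.dx.dx.ev_eq, rF.dx.dx.dx.ev_eq, rF.dt.ev_eq,
      rF.dt.dt.ev_eq, rF.dx.dt.ev_eq, rG.ev_eq, rG.dx.ev_eq, rG.dx.dx.ev_eq, rG.dx.dx.dx.ev_eq,
      rG.dx.dx.dx.dx.ev_eq, rK.ev_eq, rK.dx.ev_eq, rK.dx.dx.ev_eq, rK.dt.ev_eq, rK.dx.dt.ev_eq,
      rH.dx.ev_eq, rH.dx.dx.ev_eq, rΓ.ev_eq, rΓ.dt.ev_eq, ← potentialJet_ofReal] at h1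
    rw [hΓx x hx t ht, hΓt x hx t ht] at h1
    exact_mod_cast h1

end Necessity
end VCNLS
end

theorem mainTheorem4 (I J : Set ℝ) (hI : IsOpen I) (hI' : I.OrdConnected)
    (hJ : IsOpen J) (hJ' : J.OrdConnected)
    (f g h k : ℝ → ℝ → ℂ)
    (hf : VCNLS.SmoothOn I J f) (hg : VCNLS.SmoothOn I J g)
    (hh : VCNLS.SmoothOn I J h) (hk : VCNLS.SmoothOn I J k)
    (hf0 : ∀ x ∈ I, ∀ t ∈ J, f x t ≠ 0) (hg0 : ∀ x ∈ I, ∀ t ∈ J, g x t ≠ 0) :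
    (VCNLS.PassesPainleveTest I J f g h k →
      (∀ x ∈ I, ∀ t ∈ J, (f x t).im = 0 ∧ (g x t).im = 0) ∧
      (∀ x ∈ I, ∀ t ∈ J, (k x t).re =
        1 / 2 * VCNLS.dx (VCNLS.rePart f) x t
          + (f x t).re * (VCNLS.dx (VCNLS.rePart g) x t / (g x t).re)) ∧
      ∃ γ : ℝ → ℝ, ContDiffOn ℝ ∞ γ J ∧
        (∀ x ∈ I, ∀ t ∈ J, (h x t).im =
          VCNLS.imPotential (VCNLS.rePart f) (VCNLS.rePart g) (VCNLS.imPart k) γ x t) ∧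
        VCNLS.PotentialEquation I J (VCNLS.rePart f) (VCNLS.rePart g) (VCNLS.imPart k) γ
          (VCNLS.rePart h) ∧
        ∀ x₀ ∈ I, ∃ A B : ℝ → ℝ, ContDiffOn ℝ ∞ A J ∧ ContDiffOn ℝ ∞ B J ∧
          ∀ x ∈ I, ∀ t ∈ J, (h x t).re =
            VCNLS.rePotential (VCNLS.rePart f) (VCNLS.rePart g) (VCNLS.imPart k) γ A B x₀ x t) ∧
    ((∀ x ∈ I, ∀ t ∈ J, (f x t).im = 0 ∧ (g x t).im = 0) →
      ∀ γ : ℝ → ℝ, ContDiffOn ℝ ∞ γ J → ∀ x₀ ∈ I,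
        (∀ h₁ : ℝ → ℝ → ℝ, VCNLS.SmoothOn I J h₁ →
          VCNLS.PotentialEquation I J (VCNLS.rePart f) (VCNLS.rePart g) (VCNLS.imPart k) γ h₁ →
          ∃ A B : ℝ → ℝ, ContDiffOn ℝ ∞ A J ∧ ContDiffOn ℝ ∞ B J ∧
            ∀ x ∈ I, ∀ t ∈ J, h₁ x t =
              VCNLS.rePotential (VCNLS.rePart f) (VCNLS.rePart g) (VCNLS.imPart k) γ A B x₀ x t) ∧
        (∀ A B : ℝ → ℝ,
          VCNLS.PotentialEquation I J (VCNLS.rePart f) (VCNLS.rePart g) (VCNLS.imPart k) γ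
            (VCNLS.rePotential (VCNLS.rePart f) (VCNLS.rePart g) (VCNLS.imPart k) γ A B x₀))) := by
  obtain ⟨I, rfl⟩ : ∃ I' : TopologicalSpace.Opens ℝ, (I' : Set ℝ) = I := ⟨⟨I, hI⟩, rfl⟩
  obtain ⟨J, rfl⟩ : ∃ J' : TopologicalSpace.Opens ℝ, (J' : Set ℝ) = J := ⟨⟨J, hJ⟩, rfl⟩
  have hF0 : (∀ x ∈ I, ∀ t ∈ J, (f x t).im = 0 ∧ (g x t).im = 0) →
      ∀ x ∈ I, ∀ t ∈ J, VCNLS.rePart f x t ≠ 0 := fun hr x hx t ht h0 =>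
    hf0 x hx t ht (Complex.ext h0 (hr x hx t ht).1)
  have hG0 : (∀ x ∈ I, ∀ t ∈ J, (f x t).im = 0 ∧ (g x t).im = 0) →
      ∀ x ∈ I, ∀ t ∈ J, VCNLS.rePart g x t ≠ 0 := fun hr x hx t ht h0 =>
    hg0 x hx t ht (Complex.ext h0 (hr x hx t ht).2)
  refine ⟨fun H => ?_, fun hr γ _ x₀ hx₀ =>
    ⟨fun h₁ hh₁ heq => VCNLS.exists_eq_rePotential hI' hf.rePart hg.rePart hk.imPart
        (hF0 hr) (hG0 hr) γ hx₀ hh₁ heq,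
      fun A B => VCNLS.potentialEquation_rePotential hI' hf.rePart hg.rePart hk.imPart
        (hF0 hr) (hG0 hr) γ A B hx₀⟩⟩
  -- If an interval is empty, every condition is vacuous and zero functions serve as `γ`, `A`, `B`.
  by_cases hne : (I : Set ℝ).Nonempty ∧ (J : Set ℝ).Nonempty
  · obtain ⟨hr, hk1, γ, hγ, him, heq⟩ :=
      VCNLS.necessary_conditions hI' hf hg hh hk hf0 hg0 hne.1 hne.2 H
    exact ⟨hr, hk1, γ, hγ, him, heq, fun x₀ hx₀ =>
      VCNLS.exists_eq_rePotential hI' hf.rePart hg.rePart hk.imPart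
        (hF0 hr) (hG0 hr) γ hx₀ hh.rePart heq⟩
  · have hE : ∀ x ∈ (I : Set ℝ), ∀ t ∈ (J : Set ℝ), False :=
      fun x hx t ht => hne ⟨⟨x, hx⟩, ⟨t, ht⟩⟩
    exact ⟨fun x hx t ht => (hE x hx t ht).elim, fun x hx t ht => (hE x hx t ht).elim, 0,
      contDiffOn_const, fun x hx t ht => (hE x hx t ht).elim,
      fun x hx t ht => (hE x hx t ht).elim, fun x₀ _ => ⟨0, 0, contDiffOn_const,
        contDiffOn_const, fun x hx t ht => (hE x hx t ht).elim⟩⟩
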